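/- Let $N\in\mathbb N$, $m>0$, $\mu,\alpha,p,q\in\mathbb R$, and consider on $\mathbb R^N$ the semirelativistic Choquard equation $$\sqrt{-\Delta+m^2}\,u-mu+V(x)u-\frac{\mu}{|x|}u=\Big(\int_{\mathbb R^N}\frac{F(y,u(y))}{|x-y|^{N-\alpha}}\,dy\Big)f(x,u)-K(x)|u|^{q-2}u,\qquad u\in H^{1/2}(\mathbb R^N), \tag{1.1}$$ for real-valued $u$, where $F(x,t)=\int_0^t f(x,s)\,ds$ and $\sqrt{-\Delta+m^2}$ is the Fourier multiplier with symbol $\sqrt{|\xi|^2+m^2}$. Assume: (N) $N\ge 2$, $(N-1)p-N<\alpha<N$, $2<q<\min\{2p,\,2N/(N-1)\}$, $p>2$. (V1) $V=V_p+V_l$, where $V_p\in L^\infty(\mathbb R^N)$ is $\mathbb Z^N$-periodic and $V_l\in L^\infty(\mathbb R^N)\cap L^N(\mathbb R^N)$ satisfies $\lim_{|x|\to\infty}V_l(x)=0$. (V2') $\operatorname{ess\,inf}_{\mathbb R^N}V_p>m$. (F1) $f:\mathbb R^N\times\mathbb R\to\mathbb R$ is a Carathéodory function ($f(\cdot,u)$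 is measurable for every $u$, $f(x,\cdot)$ is continuous for a.e. $x$), $\mathbb Z^N$-periodic in $x$, and there is $C>0$ with $|f(x,u)|\le C(|u|^{\alpha/N}+|u|^{p-1})$. (F2) $f(x,u)=o(u)$ as $u\to0$, uniformly in $x$. (F3) $F(x,u)/|u|^{q/2}\to+\infty$ as $|u|\to\infty$, uniformly in $x$, and $F(x,u)\ge 0$ for $u\in\mathbb R$ and a.e. $x$. (F4) $u\mapsto f(x,u)/|u|^{(q-2)/2}$ is non-decreasing on $(-\infty,0)$ and on $(0,\infty)$. (K) $K\in L^\infty(\mathbb R^N)$ is $\mathbb Z^N$-periodic and non-negative. (Properties in $x$ are understood up to null sets.) Let $$\mathcal E(u)=\frac12\int\sqrt{|\xi|^2+m^2}\,|\hat u|^2\,d\xi+\frac12\int (V-m)u^2\,dx-\frac\mu2\int\frac{u^2}{|x|}\,dx-\frac12\iint\frac{F(x,u(x))F(y,u(y))}{|x-y|^{N-\alpha}}\,dx\,dy+\frac1q\int K|u|^q\,dx$$ on $H^{1/2}(\mathbb R^N)$, with $\hat u$ the unitary Fourier transform, and let $\mathcal N=\{u\in H^{1/2}(\mathbb R^N)\setminus\{0\}:\mathcal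 E'(u)(u)=0\}$. A *ground state* of (1.1) is a nontrivial weak solution $u\in H^{1/2}(\mathbb R^N)$ of (1.1) (a critical point of $\mathcal E$) with $\mathcal E(u)=\inf_{\mathcal N}\mathcal E$. **Theorem.** If $\mu<0$ and $V_l(x)>\mu/|x|$ for a.e. $x\in\mathbb R^N\setminus\{0\}$, then (1.1) has no ground state; more precisely, $\mathcal E$ does not even attain its infimum on $\mathcal N$. -/

import Mathlib

open MeasureTheory Filter Topology
open scoped FourierTransform ENNReal

noncomputable section

namespace Choquard

/-- Euclidean space `ℝ^N`. -/
abbrev Space (N : ℕ) : Type := EuclideanSpace ℝ (Fin N)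

/-- The real Hilbert space `L²(ℝ^N; ℝ)`. -/
abbrev L2 (N : ℕ) : Type := Lp ℝ 2 (volume : Measure (Space N))

/-- A point of `ℤ^N`, seen as a vector of `ℝ^N`. -/
def latticePt {N : ℕ} (z : Fin N → ℤ) : Space N := WithLp.toLp 2 (fun i => (z i : ℝ))

/-- A real `L²` function, seen as a complex-valued one. -/
def complexify {N : ℕ} (u : L2 N) : Lp ℂ 2 (volume : Measure (Space N)) :=
  Complex.ofRealCLM.compLp u

/-- The `L²` Fourier transform of `u`, in the normalization
`𝓕 u (ξ) = ∫ exp (-2πi x·ξ) u(x) dx`. -/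
def hat {N : ℕ} (u : L2 N) : Lp ℂ 2 (volume : Measure (Space N)) := 𝓕 (complexify u)

/-- The space `H^{1/2}(ℝ^N)` of real-valued functions. -/
def H12 (N : ℕ) : Set (L2 N) :=
  {u | TemperedDistribution.MemSobolev (1 / 2) 2
    (Lp.toTemperedDistribution (complexify u))}

/-- The symbol of `√(-Δ + m²)`. In the normalization of `hat`, the symbol of `-Δ`
is `4π²|ξ|²`. -/
def symbol {N : ℕ} (m : ℝ) (ξ : Space N) : ℝ := √((2 * Real.pi * ‖ξ‖) ^ 2 + m ^ 2)

/-- The primitive `F(x,t) = ∫₀ᵗ f(x,s) ds`. -/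
def primitive {N : ℕ} (f : Space N → ℝ → ℝ) (x : Space N) (t : ℝ) : ℝ :=
  ∫ s in (0 : ℝ)..t, f x s

/-- The double integral `𝓓(u) = ∬ F(x,u(x)) F(y,u(y)) / |x-y|^{N-α} dx dy`. -/
def doubleInt {N : ℕ} (α : ℝ) (f : Space N → ℝ → ℝ) (u : L2 N) : ℝ :=
  ∫ w : Space N × Space N,
    primitive f w.1 (u w.1) * primitive f w.2 (u w.2) / ‖w.1 - w.2‖ ^ ((N : ℝ) - α)

/-- The energy functional `𝓔` of the equation
`√(-Δ+m²) u - m u + V u - (μ/|x|) u = (∫ F(y,u(y)) / |x-y|^{N-α} dy) f(x,u) - K |u|^{q-2} u`. -/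
def energy {N : ℕ} (m μ α q : ℝ) (V K : Space N → ℝ) (f : Space N → ℝ → ℝ) (u : L2 N) : ℝ :=
  (1 / 2) * (∫ ξ, symbol m ξ * ‖hat u ξ‖ ^ 2)
    + (1 / 2) * (∫ x, (V x - m) * u x ^ 2)
    - (μ / 2) * (∫ x, u x ^ 2 / ‖x‖)
    - (1 / 2) * doubleInt α f u
    + (1 / q) * (∫ x, K x * |u x| ^ q)

/-- The derivative `𝓔'(u)(φ)`, that is, the weak form of the equation at `u`, tested with `φ`. -/
def energyDeriv {N : ℕ} (m μ α q : ℝ) (V K : Space N → ℝ) (f : Space N → ℝ → ℝ)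
    (u φ : L2 N) : ℝ :=
  (∫ ξ, symbol m ξ * (hat u ξ * (starRingEnd ℂ) (hat φ ξ)).re)
    + (∫ x, (V x - m) * u x * φ x)
    - μ * (∫ x, u x * φ x / ‖x‖)
    - (∫ w : Space N × Space N,
        primitive f w.1 (u w.1) * (f w.2 (u w.2) * φ w.2) / ‖w.1 - w.2‖ ^ ((N : ℝ) - α))
    + (∫ x, K x * |u x| ^ (q - 2) * u x * φ x)

/-- Weak solutions in `H^{1/2}(ℝ^N)` of the equation, that is, critical points of `𝓔`. -/
def IsWeakSolution {N : ℕ} (m μ α q : ℝ) (V K : Space N → ℝ) (f : Space N → ℝ → ℝ)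
    (u : L2 N) : Prop :=
  u ∈ H12 N ∧ ∀ φ ∈ H12 N, energyDeriv m μ α q V K f u φ = 0

/-- The Nehari manifold `{u ∈ H^{1/2}(ℝ^N) ∖ {0} | 𝓔'(u)(u) = 0}`. -/
def nehari {N : ℕ} (m μ α q : ℝ) (V K : Space N → ℝ) (f : Space N → ℝ → ℝ) : Set (L2 N) :=
  {u | u ∈ H12 N ∧ u ≠ 0 ∧ energyDeriv m μ α q V K f u u = 0}

/-- A ground state: a nontrivial weak solution whose energy is the least energy on the
Nehari manifold. -/
def IsGroundState {N : ℕ} (m μ α q : ℝ) (V K : Space N → ℝ) (f : Space N → ℝ → ℝ)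
    (u : L2 N) : Prop :=
  IsWeakSolution m μ α q V K f u ∧ u ≠ 0 ∧
    IsLeast (energy m μ α q V K f '' nehari m μ α q V K f) (energy m μ α q V K f u)

/-- Condition (N) on the dimension and the exponents. -/
structure CondN (N : ℕ) (α p q : ℝ) : Prop where
  two_le : 2 ≤ N
  lower : ((N : ℝ) - 1) * p - N < α
  upper : α < N
  q_gt : 2 < q
  q_lt : q < min (2 * p) (2 * N / ((N : ℝ) - 1))
  p_gt : 2 < p

/-- `ℤ^N`-periodicity of an almost everywhere defined function. -/
def Periodic {N : ℕ} (g : Space N → ℝ) : Prop :=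
  ∀ z : Fin N → ℤ, ∀ᵐ x, g (x + latticePt z) = g x

/-- Condition (V1): `V = V_p + V_l` with `V_p ∈ L^∞` periodic and `V_l ∈ L^∞ ∩ L^N` vanishing
(up to a null set) at infinity. -/
structure CondV1 {N : ℕ} (V Vp Vl : Space N → ℝ) : Prop where
  decomp : ∀ᵐ x, V x = Vp x + Vl x
  memLp_p : MemLp Vp ∞ volume
  periodic_p : Periodic Vp
  memLp_l : MemLp Vl ∞ volume
  memLp_l' : MemLp Vl (N : ℝ≥0∞) volume
  tendsto_l : Tendsto Vl (Bornology.cobounded (Space N) ⊓ ae volume) (𝓝 0)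

/-- Condition (F1): `f` is a Carathéodory function, `ℤ^N`-periodic in `x`, with
`|f(x,u)| ≤ C (|u|^{α/N} + |u|^{p-1})`. -/
structure CondF1 {N : ℕ} (α p : ℝ) (f : Space N → ℝ → ℝ) : Prop where
  measurable : ∀ t, AEMeasurable (fun x => f x t) volume
  continuous : ∀ᵐ x, Continuous (f x)
  periodic : ∀ z : Fin N → ℤ, ∀ᵐ x, ∀ t, f (x + latticePt z) t = f x t
  growth : ∃ C > 0, ∀ᵐ x, ∀ t, |f x t| ≤ C * (|t| ^ (α / N) + |t| ^ (p - 1))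

/-- Condition (F2): `f(x,u) = o(u)` as `u → 0`, uniformly in `x`. -/
def CondF2 {N : ℕ} (f : Space N → ℝ → ℝ) : Prop :=
  ∀ ε > 0, ∃ δ > 0, ∀ᵐ x, ∀ t, |t| < δ → |f x t| ≤ ε * |t|

/-- Condition (F3): `F(x,u)/|u|^{q/2} → ∞` as `|u| → ∞`, uniformly in `x`, and `F ≥ 0`. -/
structure CondF3 {N : ℕ} (q : ℝ) (f : Space N → ℝ → ℝ) : Prop where
  superlinear : ∀ M : ℝ, ∃ R > 0, ∀ᵐ x, ∀ t, R ≤ |t| → M ≤ primitive f x t / |t| ^ (q / 2)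
  nonneg : ∀ᵐ x, ∀ t, 0 ≤ primitive f x t

/-- Condition (F4): `u ↦ f(x,u)/|u|^{(q-2)/2}` is non-decreasing on each half-line. -/
def CondF4 {N : ℕ} (q : ℝ) (f : Space N → ℝ → ℝ) : Prop :=
  ∀ᵐ x, MonotoneOn (fun t => f x t / |t| ^ ((q - 2) / 2)) (Set.Iio 0) ∧
    MonotoneOn (fun t => f x t / |t| ^ ((q - 2) / 2)) (Set.Ioi 0)

/-- Condition (K): `K ∈ L^∞` is `ℤ^N`-periodic and non-negative. -/
structure CondK {N : ℕ} (K : Space N → ℝ) : Prop where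
  memLp : MemLp K ∞ volume
  periodic : Periodic K
  nonneg : ∀ᵐ x, 0 ≤ K x

end Choquard

end

/-!
The energy is invariant under translations by lattice vectors, except for the localized part
`R(u) = ∫ (V_l - μ/|x|) u²` of its quadratic form, which by hypothesis is positive for `u ≠ 0`.
If `u` minimized the energy on the Nehari manifold, its translates `v = u(· + a)` would satisfy
`R(v) → 0` as `|a| → ∞`, so `R(v) < R(u)` for some lattice vector `a`. Some multiple `t v`, `t > 0`,
lies on the Nehari manifold, and
`𝓔(t v) = 𝓔(t u) + t² (R(v) - R(u)) / 2 < 𝓔(t u) ≤ 𝓔(u)`,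
a contradiction (`IsRegular.not_isMinOn_nehari`). A ground state is in particular such a minimizer.

The argument rests on two groups of facts.

*Behaviour along rays.* That `u` maximizes the energy on the ray through it
(`IsRegular.energy_smul_le`) and that each ray meets the Nehari manifold
(`IsRegular.exists_smul_mem_nehari`) follow from the monotonicity of `f(x, t) / |t|^{(q-2)/2}`
and, for the second, the superlinear growth of `F`. The monotonicity makes
`t ↦ F(x, t u) F(y, t v)` grow at least like `t^q`, in the precise sense of
`IsFibre.mul_sub_mul_ge`; no smoothness of `f` is needed.

*Integrability.* The argument needs the finiteness of the nonlocal energy, of `∫ u²/|x|`, and the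
convergence `∫ u(x + a)²/|x| → 0`. All of them come from one splitting of `u` at a frequency `Λ`
(`exists_frequency_splitting`), with low part bounded by the `L¹` norm of `û` on a ball and high
part small in `L²`. With `Λ` chosen according to the level set it gives the subcritical Sobolev
embedding (`lintegral_rpow_lt_top`). With `Λ` equal to an inverse radius it gives
a bound for the mass on balls that is uniform in the centre (`exists_integrable_bound_ball`), hence
Hardy's inequality and, by dominated convergence, its vanishing version for translates. The nonlocal
energy is controlled by a subcritical form of the Hardy–Littlewood–Sobolev inequality
(`integrable_mul_mul_div_norm_rpow`), for which Young's inequality suffices.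
-/

open MeasureTheory Filter Topology
open scoped FourierTransform ENNReal

noncomputable section

namespace Choquard

/-! ### The Fourier transform on `L²` -/

section Fourier

variable {E : Type*} [NormedAddCommGroup E] [InnerProductSpace ℝ E] [FiniteDimensional ℝ E]
  [MeasurableSpace E] [BorelSpace E]

/-- The inverse Fourier integral can be moved onto a test function. -/
theorem integral_fourierInv_smul_eq {g φ : E → ℂ} (hg : Integrable g) (hφ : Integrable φ) :
    ∫ x, φ x • 𝓕⁻ g x = ∫ ξ, 𝓕⁻ φ ξ • g ξ := by
  have hc : Continuous fun p : E × E => (-innerₗ E) p.1 p.2 := by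
    simp only [LinearMap.neg_apply, innerₗ_apply_apply]; fun_prop
  have := VectorFourier.integral_fourierIntegral_smul_eq_flip (μ := (volume : Measure E))
    (ν := (volume : Measure E)) (f := φ) (g := g)
    (L := -innerₗ E) Real.continuous_fourierChar hc hφ hg
  have hflip : (-innerₗ E).flip = -innerₗ E := by
    ext x y; simp [real_inner_comm]
  rw [hflip] at this
  exact this.symm

theorem continuous_fourierInv {g : E → ℂ} (hg : Integrable g) : Continuous (𝓕⁻ g) := by
  have hc : Continuous fun p : E × E => (-innerₗ E) p.1 p.2 := by
    simp only [LinearMap.neg_apply, innerₗ_apply_apply]; fun_prop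
  exact VectorFourier.fourierIntegral_continuous Real.continuous_fourierChar hc hg

/-- On `L¹ ∩ L²` the `L²` inverse Fourier transform is given by the Fourier integral. -/
theorem fourierInv_toLp_ae_eq {g : E → ℂ} (h1 : Integrable g) (h2 : MemLp g 2 volume) :
    ((𝓕⁻ (h2.toLp g) : Lp ℂ 2 (volume : Measure E)) : E → ℂ) =ᵐ[volume] 𝓕⁻ g := by
  apply ae_eq_of_integral_contDiff_smul_eq
  · exact (Lp.memLp _).locallyIntegrable (by norm_num)
  · exact (continuous_fourierInv h1).locallyIntegrable
  · intro φ hφ hc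
    have hg₁ : HasCompactSupport (Complex.ofRealCLM ∘ φ) := hc.comp_left rfl
    have hg₂ : ContDiff ℝ ((⊤ : ℕ∞) : WithTop ℕ∞) (Complex.ofRealCLM ∘ φ) := by fun_prop
    set Φ := hg₁.toSchwartzMap hg₂
    have e1 : ∀ h : E → ℂ, (fun x => φ x • h x) = fun x => Φ x • h x := by
      intro h; ext x; simp [Φ]
    rw [e1, e1, integral_fourierInv_smul_eq h1 Φ.integrable,
      ← Lp.toTemperedDistribution_apply, ← Lp.fourierInv_toTemperedDistribution_eq,
      TemperedDistribution.fourierInv_apply, Lp.toTemperedDistribution_apply]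
    apply integral_congr_ae
    filter_upwards [h2.coeFn_toLp] with x hx
    rw [hx, SchwartzMap.fourierInv_coe]

/-- Translation `u ↦ u(· + a)` on `L²`. -/
def shift {F : Type*} [NormedAddCommGroup F] (a : E) (u : Lp F 2 (volume : Measure E)) :
    Lp F 2 (volume : Measure E) :=
  Lp.compMeasurePreserving (· + a) (measurePreserving_add_right volume a) u

theorem coeFn_shift {F : Type*} [NormedAddCommGroup F] (a : E)
    (u : Lp F 2 (volume : Measure E)) : shift a u =ᵐ[volume] fun x => u (x + a) :=
  Lp.coeFn_compMeasurePreserving u _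

theorem memLp_fourierChar_inner (a : E) :
    MemLp (fun ξ : E => (Real.fourierChar (inner ℝ a ξ) : ℂ)) ∞ volume := by
  refine memLp_top_of_bound ?_ 1 (Eventually.of_forall fun ξ => (Circle.norm_coe _).le)
  exact (Continuous.subtype_val
    (Real.continuous_fourierChar.comp (by fun_prop))).aestronglyMeasurable

/-- The Fourier transform turns translations into modulations. -/
theorem fourier_shift (a : E) (u : Lp ℂ 2 (volume : Measure E)) :
    𝓕 (shift a u) = (ContinuousLinearMap.lsmul ℂ ℂ).holderL volume ∞ 2 2
      ((memLp_fourierChar_inner a).toLp _) (𝓕 u) := by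
  apply DenseRange.induction_on (p := fun u => 𝓕 (shift a u) =
      (ContinuousLinearMap.lsmul ℂ ℂ).holderL volume ∞ 2 2
      ((memLp_fourierChar_inner a).toLp _) (𝓕 u))
    (SchwartzMap.denseRange_toLpCLM (p := 2) (E := E) (F := ℂ) (μ := volume)
      ENNReal.ofNat_ne_top) u
  · apply isClosed_eq
    · exact (Lp.fourierTransformₗᵢ E ℂ).continuous.comp
        (Lp.isometry_compMeasurePreserving (measurePreserving_add_right volume a)).continuous
    · exact (ContinuousLinearMap.continuous _).comp (Lp.fourierTransformₗᵢ E ℂ).continuous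
  · intro φ
    have h1 : shift a (φ.toLp 2 volume) = (SchwartzMap.compSubConstCLM ℂ (-a) φ).toLp 2 volume := by
      apply Lp.ext
      refine (coeFn_shift _ _).trans ?_
      have := (measurePreserving_add_right (volume : Measure E) a).quasiMeasurePreserving.ae_eq_comp
        (φ.coeFn_toLp 2 volume)
      filter_upwards [this, SchwartzMap.coeFn_toLp (SchwartzMap.compSubConstCLM ℂ (-a) φ) 2 volume]
        with x h1 h2
      simp only [Function.comp] at h1
      rw [h1, h2]; simp
    rw [SchwartzMap.toLpCLM_apply, h1, SchwartzMap.toLp_fourier_eq, SchwartzMap.toLp_fourier_eq]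
    apply Lp.ext
    rw [ContinuousLinearMap.holderL_apply_apply]
    filter_upwards [SchwartzMap.coeFn_toLp (𝓕 (SchwartzMap.compSubConstCLM ℂ (-a) φ)) 2 volume,
      SchwartzMap.coeFn_toLp (𝓕 φ) 2 volume, (memLp_fourierChar_inner a).coeFn_toLp,
      ContinuousLinearMap.coeFn_holder (r := 2) (ContinuousLinearMap.lsmul ℂ ℂ)
      ((memLp_fourierChar_inner a).toLp _) ((𝓕 φ).toLp 2 volume)] with ξ h1 h2 h3 h4
    rw [h1, h4, h3, h2, SchwartzMap.fourier_coe, SchwartzMap.fourier_coe]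
    have := congrFun (VectorFourier.fourierIntegral_comp_add_right Real.fourierChar
      (volume : Measure E) (innerₗ E) φ a) ξ
    simp only [ContinuousLinearMap.lsmul_apply]
    have e : ((SchwartzMap.compSubConstCLM ℂ (-a) φ : SchwartzMap E ℂ) : E → ℂ)
      = φ ∘ fun v => v + a := by ext; simp
    rw [e]
    exact this

theorem norm_fourier_shift (a : E) (u : Lp ℂ 2 (volume : Measure E)) :
    ∀ᵐ ξ, ‖𝓕 (shift a u) ξ‖ = ‖𝓕 u ξ‖ := by
  rw [fourier_shift, ContinuousLinearMap.holderL_apply_apply]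
  filter_upwards [(memLp_fourierChar_inner a).coeFn_toLp,
      ContinuousLinearMap.coeFn_holder (r := 2) (ContinuousLinearMap.lsmul ℂ ℂ)
      ((memLp_fourierChar_inner a).toLp _) (𝓕 u)] with ξ h3 h4
  rw [h4, h3, ContinuousLinearMap.lsmul_apply, norm_smul, Circle.norm_coe, one_mul]

/-- The product of an `L²` function, seen as a distribution, with a smooth weight is given by an
`L²` function if and only if the pointwise product is in `L²`. -/
theorem exists_smulLeftCLM_eq_iff {g : E → ℂ} (hg : g.HasTemperateGrowth)
    (h : Lp ℂ 2 (volume : Measure E)) :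
    (∃ f' : Lp ℂ 2 (volume : Measure E),
      TemperedDistribution.smulLeftCLM ℂ g (Lp.toTemperedDistribution h) = f') ↔
      MemLp (fun ξ => g ξ * h ξ) 2 volume := by
  constructor
  · rintro ⟨f', hf'⟩
    refine (memLp_congr_ae ?_).1 (Lp.memLp f')
    apply ae_eq_of_integral_contDiff_smul_eq
    · exact (Lp.memLp _).locallyIntegrable (by norm_num)
    · exact LocallyIntegrable.continuous_smul hg.1.continuous
        ((Lp.memLp h).locallyIntegrable (by norm_num))
    · intro φ hφ hc
      have hg₁ : HasCompactSupport (Complex.ofRealCLM ∘ φ) := hc.comp_left rfl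
      have hg₂ : ContDiff ℝ ((⊤ : ℕ∞) : WithTop ℕ∞) (Complex.ofRealCLM ∘ φ) := by fun_prop
      have := DFunLike.congr_fun hf' (hg₁.toSchwartzMap hg₂)
      rw [TemperedDistribution.smulLeftCLM_apply_apply, Lp.toTemperedDistribution_apply,
        Lp.toTemperedDistribution_apply] at this
      simpa [SchwartzMap.smulLeftCLM_apply_apply hg, mul_assoc, mul_left_comm] using this.symm
  · intro hm
    refine ⟨hm.toLp _, ?_⟩
    ext φ
    rw [TemperedDistribution.smulLeftCLM_apply_apply, Lp.toTemperedDistribution_apply,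
        Lp.toTemperedDistribution_apply]
    apply integral_congr_ae
    filter_upwards [hm.coeFn_toLp] with x hx
    rw [hx]
    simp [SchwartzMap.smulLeftCLM_apply_apply hg, mul_assoc, mul_left_comm]

end Fourier

/-! ### Splitting at a frequency -/

section FrequencySplitting

variable {E : Type*} [NormedAddCommGroup E] [InnerProductSpace ℝ E] [FiniteDimensional ℝ E]
  [MeasurableSpace E] [BorelSpace E]

theorem lintegral_ball_rpow_neg (hd : 1 ≤ Module.finrank ℝ E) {a : ℝ}
    (ha : a < Module.finrank ℝ E) :
    ∃ C : ℝ, 0 < C ∧ ∀ Λ : ℝ, 0 < Λ →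
      ∫⁻ ξ in Metric.ball (0 : E) Λ, ENNReal.ofReal (‖ξ‖ ^ (-a)) ≤
        ENNReal.ofReal (C * Λ ^ (Module.finrank ℝ E - a)) := by
  have hint : ∀ r : ℝ, IntegrableOn (fun ξ : E => ‖ξ‖ ^ (-a)) (Metric.ball 0 r) volume := by
    intro r
    refine integrableOn_ball_of_norm_le_rpow (C := 1) (α := a) hd ha ?_ ?_
    · refine Eventually.of_forall fun x => ?_
      rw [Real.norm_of_nonneg (by positivity), one_mul]
    · exact (measurable_norm.pow_const _).aestronglyMeasurable
  refine ⟨(∫ ξ in Metric.ball (0 : E) 1, ‖ξ‖ ^ (-a)) + 1, ?_, ?_⟩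
  · have : 0 ≤ ∫ ξ in Metric.ball (0 : E) 1, ‖ξ‖ ^ (-a) := by positivity
    linarith
  intro Λ hΛ
  rw [← ofReal_integral_eq_lintegral_ofReal (hint Λ)
    (Eventually.of_forall fun x => by positivity)]
  apply ENNReal.ofReal_le_ofReal
  have h := Measure.setIntegral_comp_smul_of_pos (volume : Measure E) (fun ξ : E => ‖ξ‖ ^ (-a))
    (Metric.ball (0 : E) 1) hΛ
  rw [smul_unitBall_of_pos hΛ] at h
  have h2 : ∫ ξ in Metric.ball (0 : E) 1, ‖Λ • ξ‖ ^ (-a) =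
      Λ ^ (-a) * ∫ ξ in Metric.ball (0 : E) 1, ‖ξ‖ ^ (-a) := by
    rw [← integral_const_mul]
    congr with ξ
    rw [norm_smul, Real.norm_of_nonneg hΛ.le, Real.mul_rpow hΛ.le (norm_nonneg _)]
  rw [h2, smul_eq_mul] at h
  have h3 : ∫ ξ in Metric.ball (0 : E) Λ, ‖ξ‖ ^ (-a) =
      Λ ^ (Module.finrank ℝ E - a) * ∫ ξ in Metric.ball (0 : E) 1, ‖ξ‖ ^ (-a) := by
    rw [sub_eq_add_neg, Real.rpow_add hΛ, Real.rpow_natCast, mul_assoc, h, ← mul_assoc,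
      mul_inv_cancel₀ (by positivity), one_mul]
  rw [h3, mul_comm]
  gcongr
  linarith

/-- Cauchy–Schwarz with a power weight on a ball. -/
theorem lintegral_ball_enorm_sq_le (hd : 1 ≤ Module.finrank ℝ E) {a : ℝ}
    (ha : a < Module.finrank ℝ E) :
    ∃ C : ℝ, 0 < C ∧ ∀ Λ : ℝ, 0 < Λ → ∀ h : E → ℂ, AEStronglyMeasurable h volume →
      (∫⁻ ξ in Metric.ball (0 : E) Λ, ‖h ξ‖ₑ) ^ 2 ≤
        ENNReal.ofReal (C * Λ ^ (Module.finrank ℝ E - a)) *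
          ∫⁻ ξ in Metric.ball (0 : E) Λ, ENNReal.ofReal (‖ξ‖ ^ a) * ‖h ξ‖ₑ ^ 2 := by
  have : Nontrivial E := Module.nontrivial_of_finrank_pos (R := ℝ) (by omega)
  obtain ⟨C, hC, hball⟩ := lintegral_ball_rpow_neg (E := E) hd ha
  refine ⟨C, hC, fun Λ hΛ h hh => ?_⟩
  refine le_trans ?_ (mul_le_mul_left (hball Λ hΛ) _)
  have hne : ∀ᵐ ξ ∂(volume.restrict (Metric.ball (0 : E) Λ)), ξ ≠ 0 :=
    ae_restrict_of_ae (by simp [ae_iff])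
  have key := ENNReal.lintegral_mul_le_Lp_mul_Lq (volume.restrict (Metric.ball (0 : E) Λ))
    Real.HolderConjugate.two_two
    (f := fun ξ => ENNReal.ofReal (‖ξ‖ ^ (-a / 2)))
    (g := fun ξ => ENNReal.ofReal (‖ξ‖ ^ (a / 2)) * ‖h ξ‖ₑ)
    (by fun_prop) (by fun_prop)
  have e0 : ∫⁻ ξ in Metric.ball (0 : E) Λ, ‖h ξ‖ₑ =
      ∫⁻ ξ in Metric.ball (0 : E) Λ, ((fun ξ : E => ENNReal.ofReal (‖ξ‖ ^ (-a / 2))) *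
        (fun ξ : E => ENNReal.ofReal (‖ξ‖ ^ (a / 2)) * ‖h ξ‖ₑ) : E → ℝ≥0∞) ξ := by
    apply lintegral_congr_ae
    filter_upwards [hne] with ξ hξ
    have hpos : 0 < ‖ξ‖ := norm_pos_iff.2 hξ
    rw [Pi.mul_apply, ← mul_assoc, ← ENNReal.ofReal_mul (by positivity), ← Real.rpow_add hpos]
    simp [neg_div]
  have e1 : ∫⁻ ξ in Metric.ball (0 : E) Λ, ENNReal.ofReal (‖ξ‖ ^ (-a / 2)) ^ (2 : ℝ) =
      ∫⁻ ξ in Metric.ball (0 : E) Λ, ENNReal.ofReal (‖ξ‖ ^ (-a)) := by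
    congr with ξ
    rw [ENNReal.ofReal_rpow_of_nonneg (by positivity) (by norm_num),
      ← Real.rpow_mul (norm_nonneg _)]
    ring_nf
  have e2 : ∫⁻ ξ in Metric.ball (0 : E) Λ, (ENNReal.ofReal (‖ξ‖ ^ (a / 2)) * ‖h ξ‖ₑ) ^ (2 : ℝ) =
      ∫⁻ ξ in Metric.ball (0 : E) Λ, ENNReal.ofReal (‖ξ‖ ^ a) * ‖h ξ‖ₑ ^ 2 := by
    congr with ξ
    rw [ENNReal.mul_rpow_of_nonneg _ _ (by norm_num),
      ENNReal.ofReal_rpow_of_nonneg (by positivity) (by norm_num),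
      ← Real.rpow_mul (norm_nonneg _)]
    norm_num
  rw [e1, e2] at key
  rw [e0]
  calc _ ≤ _ := pow_le_pow_left₀ (by positivity) key 2
    _ = _ := by
      simp only [mul_pow, ← ENNReal.rpow_natCast, ← ENNReal.rpow_mul]
      norm_num

theorem lintegral_enorm_sq_eq (u : Lp ℂ 2 (volume : Measure E)) :
    ∫⁻ x, ‖u x‖ₑ ^ 2 = ‖u‖ₑ ^ 2 := by
  rw [Lp.enorm_def, eLpNorm_eq_lintegral_rpow_enorm_toReal (by norm_num) (by norm_num),
    ← ENNReal.rpow_natCast, ← ENNReal.rpow_mul]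
  norm_num

/-- The frequencies below `Λ` contribute a bounded function, the others a function whose `L²`
norm is the tail of the Fourier transform. -/
theorem exists_frequency_splitting (v : Lp ℂ 2 (volume : Measure E)) (Λ : ℝ) :
    ∃ b : E → ℂ, AEStronglyMeasurable b volume ∧
      ∫⁻ x, ‖b x‖ₑ ^ 2 = ∫⁻ ξ in (Metric.ball (0 : E) Λ)ᶜ, ‖𝓕 v ξ‖ₑ ^ 2 ∧
      ∀ᵐ x, ‖v x‖ₑ ≤ (∫⁻ ξ in Metric.ball (0 : E) Λ, ‖𝓕 v ξ‖ₑ) + ‖b x‖ₑ := by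
  set B := Metric.ball (0 : E) Λ
  have hB : MeasurableSet B := Metric.isOpen_ball.measurableSet
  obtain ⟨h, hh⟩ : ∃ h : Lp ℂ 2 (volume : Measure E), h = 𝓕 v := ⟨_, rfl⟩
  rw [← hh]
  have hm := Lp.memLp h
  have hlow : MemLp (B.indicator h) 2 volume := hm.indicator hB
  have hhigh : MemLp (Bᶜ.indicator h) 2 volume := hm.indicator hB.compl
  have hint : Integrable (B.indicator h) volume := by
    rw [integrable_indicator_iff hB]
    have : IsFiniteMeasure (volume.restrict B) :=
      ⟨by rw [Measure.restrict_apply_univ]; exact measure_ball_lt_top⟩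
    exact (hm.restrict B).integrable (by norm_num)
  have hsum : h = hlow.toLp _ + hhigh.toLp _ := by
    apply Lp.ext
    filter_upwards [Lp.coeFn_add (hlow.toLp _) (hhigh.toLp _), hlow.coeFn_toLp,
      hhigh.coeFn_toLp] with x h1 h2 h3
    rw [h1, Pi.add_apply, h2, h3, ← Pi.add_apply, Set.indicator_self_add_compl]
  have hv : v = 𝓕⁻ (hlow.toLp _) + 𝓕⁻ (hhigh.toLp _) := by
    rw [← FourierTransform.fourierInv_add, ← hsum, hh, FourierTransform.fourierInv_fourier_eq]
  refine ⟨(𝓕⁻ (hhigh.toLp _) : Lp ℂ 2 (volume : Measure E)),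
    Lp.aestronglyMeasurable _, ?_, ?_⟩
  · rw [lintegral_enorm_sq_eq]
    have : ‖(𝓕⁻ (hhigh.toLp _) : Lp ℂ 2 (volume : Measure E))‖ₑ = ‖hhigh.toLp _‖ₑ := by
      rw [← ofReal_norm, ← ofReal_norm, ← Lp.norm_fourier_eq (𝓕⁻ (hhigh.toLp _)),
        FourierTransform.fourier_fourierInv_eq]
    rw [this, ← lintegral_enorm_sq_eq, ← lintegral_indicator hB.compl]
    apply lintegral_congr_ae
    filter_upwards [hhigh.coeFn_toLp] with x hx
    rw [hx]
    by_cases hx' : x ∈ Bᶜ <;> simp [hx']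
  · filter_upwards [Lp.coeFn_add (𝓕⁻ (hlow.toLp _) : Lp ℂ 2 (volume : Measure E))
      (𝓕⁻ (hhigh.toLp _)), fourierInv_toLp_ae_eq hint hlow] with x h1 h2
    have h3 : v x = 𝓕⁻ (B.indicator h) x + (𝓕⁻ (hhigh.toLp _) : Lp ℂ 2 (volume : Measure E)) x := by
      conv_lhs => rw [hv]
      rw [h1, Pi.add_apply, h2]
    rw [h3]
    refine (enorm_add_le _ _).trans ?_
    gcongr
    rw [Real.fourierInv_eq]
    refine (enorm_integral_le_lintegral_enorm _).trans (le_of_eq ?_)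
    rw [← lintegral_indicator hB]
    congr with ξ
    rw [← ofReal_norm, Circle.norm_smul, ofReal_norm]
    by_cases hx' : ξ ∈ B <;> simp [hx']

end FrequencySplitting

/-! ### Bounds for functions with half a derivative in `L²` -/

section HalfDerivative

variable {E : Type*} [NormedAddCommGroup E] [InnerProductSpace ℝ E] [FiniteDimensional ℝ E]
  [MeasurableSpace E] [BorelSpace E]

theorem ennreal_add_sq_le (a b : ℝ≥0∞) : (a + b) ^ 2 ≤ 2 * a ^ 2 + 2 * b ^ 2 := by
  have := ENNReal.rpow_add_le_mul_rpow_add_rpow a b (p := 2) (by norm_num)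
  norm_num at this
  rw [← mul_add]; exact_mod_cast this

/-- Uniform local bound behind Hardy's inequality: the mass of `v` on balls of radius `1/l` has a
majorant that is integrable in `l` and does not depend on the centre. -/
theorem exists_integrable_bound_ball (hd : 2 ≤ Module.finrank ℝ E)
    (v : Lp ℂ 2 (volume : Measure E))
    (hv : ∫⁻ ξ, ENNReal.ofReal ‖ξ‖ * ‖𝓕 v ξ‖ₑ ^ 2 < ∞) :
    ∃ g : ℝ → ℝ≥0∞, ∫⁻ l in Set.Ioi 0, g l < ∞ ∧
      ∀ l, 0 < l → ∀ y : E, ∫⁻ x in Metric.ball y l⁻¹, ‖v x‖ₑ ^ 2 ≤ g l := by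
  have : Nontrivial E := Module.nontrivial_of_finrank_pos (R := ℝ) (by omega)
  have hd' : (2 : ℝ) ≤ Module.finrank ℝ E := by exact_mod_cast hd
  -- any exponent in `(1, 2)` would do: below the dimension for Cauchy–Schwarz on balls, above `1`
  -- for the integrability of the low frequency term in `l`
  obtain ⟨C, hC, hCS⟩ := lintegral_ball_enorm_sq_le (E := E) (a := 3 / 2) (by omega) (by linarith)
  obtain ⟨h, hh⟩ : ∃ h : Lp ℂ 2 (volume : Measure E), h = 𝓕 v := ⟨_, rfl⟩
  have hsplit := exists_frequency_splitting v
  simp only [← hh] at hv hsplit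
  have hhm : Measurable h := (Lp.stronglyMeasurable h).measurable
  set V := (volume (Metric.ball (0 : E) 1)).toReal
  have hV : ENNReal.ofReal V = volume (Metric.ball (0 : E) 1) :=
    ENNReal.ofReal_toReal measure_ball_lt_top.ne
  have hV0 : 0 ≤ V := ENNReal.toReal_nonneg
  let w : E → ℝ≥0∞ := fun ξ => ENNReal.ofReal (‖ξ‖ ^ (3 / 2 : ℝ)) * ‖h ξ‖ₑ ^ 2
  have hw : Measurable w := by
    refine Measurable.mul (ENNReal.measurable_ofReal.comp (measurable_norm.pow_const _)) ?_
    exact hhm.enorm.pow_const _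
  -- the frequencies below and above `l` contribute `∫ G1 l` and `∫ G2 l` to the mass on a ball of
  -- radius `1 / l`; integrating in `l` first, both leave the weight `‖ξ‖`
  let G1 : ℝ → E → ℝ≥0∞ := fun l ξ => (Metric.ball (0 : E) l).indicator
    (fun ξ => ENNReal.ofReal (2 * V * C * l ^ (-(3 / 2) : ℝ)) * w ξ) ξ
  let G2 : ℝ → E → ℝ≥0∞ := fun l ξ =>
    (Metric.ball (0 : E) l)ᶜ.indicator (fun ξ => 2 * ‖h ξ‖ₑ ^ 2) ξ
  refine ⟨fun l => (∫⁻ ξ, G1 l ξ) + ∫⁻ ξ, G2 l ξ, ?_, ?_⟩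
  · have hS : MeasurableSet {p : ℝ × E | ‖p.2‖ < p.1} :=
      measurableSet_lt (measurable_norm.comp measurable_snd) measurable_fst
    have hG1 : Measurable (Function.uncurry G1) := by
      have : Function.uncurry G1 = {p : ℝ × E | ‖p.2‖ < p.1}.indicator
          (fun p => ENNReal.ofReal (2 * V * C * p.1 ^ (-(3 / 2) : ℝ)) * w p.2) := by
        ext p
        simp only [Function.uncurry, G1, Set.indicator, mem_ball_zero_iff, Set.mem_ofPred_eq]
      rw [this]
      refine Measurable.indicator (Measurable.mul ?_ (hw.comp measurable_snd)) hS
      exact ENNReal.measurable_ofReal.comp ((measurable_fst.pow_const _).const_mul _)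
    have hG2 : Measurable (Function.uncurry G2) := by
      have : Function.uncurry G2 = {p : ℝ × E | ‖p.2‖ < p.1}ᶜ.indicator
          (fun p => 2 * ‖h p.2‖ₑ ^ 2) := by
        ext p
        simp only [Function.uncurry, G2, Set.indicator, mem_ball_zero_iff, Set.mem_ofPred_eq,
          Set.mem_compl_iff]
      rw [this]
      exact Measurable.indicator
        (((hhm.comp measurable_snd).enorm.pow_const _).const_mul _) hS.compl
    simp only
    rw [lintegral_add_left (f := fun l => ∫⁻ ξ, G1 l ξ) hG1.lintegral_prod_right',
      ENNReal.add_lt_top]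
    constructor
    · rw [lintegral_lintegral_swap hG1.aemeasurable]
      have hb : ∀ᵐ ξ : E, ∫⁻ l in Set.Ioi 0, G1 l ξ ≤
          ENNReal.ofReal (4 * V * C) * (ENNReal.ofReal ‖ξ‖ * ‖h ξ‖ₑ ^ 2) := by
        have hne : ∀ᵐ ξ : E, ξ ≠ 0 := by simp [ae_iff]
        filter_upwards [hne] with ξ hξ
        have hpos : 0 < ‖ξ‖ := norm_pos_iff.2 hξ
        have e1 : ∀ l, G1 l ξ = (Set.Ioi ‖ξ‖).indicator
            (fun l => ENNReal.ofReal (2 * V * C * l ^ (-(3 / 2) : ℝ)) * w ξ) l := by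
          intro l
          simp only [G1, Set.indicator, mem_ball_zero_iff, Set.mem_Ioi]
        simp_rw [e1]
        rw [lintegral_indicator measurableSet_Ioi, Measure.restrict_restrict measurableSet_Ioi,
          Set.inter_eq_left.2 (Set.Ioi_subset_Ioi hpos.le), lintegral_mul_const' _ _ (by
            exact ENNReal.mul_ne_top ENNReal.ofReal_ne_top (by simp)),
          ← ofReal_integral_eq_lintegral_ofReal, integral_const_mul,
          integral_Ioi_rpow_of_lt (by norm_num) hpos, ← mul_assoc, ← mul_assoc,
          ← ENNReal.ofReal_mul', ← ENNReal.ofReal_mul (by positivity)]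
        · refine mul_le_mul_left (ENNReal.ofReal_le_ofReal ?_) _
          rw [show (-(3 / 2) + 1 : ℝ) = 1 / 2 - 1 by norm_num, Real.rpow_sub hpos,
            show (3 / 2 : ℝ) = 1 / 2 + 1 / 2 + 1 / 2 by norm_num, Real.rpow_add hpos,
            Real.rpow_add hpos]
          have hs : ‖ξ‖ ^ (1 / 2 : ℝ) * ‖ξ‖ ^ (1 / 2 : ℝ) = ‖ξ‖ := by
            rw [← Real.rpow_add hpos]; norm_num
          rw [hs, Real.rpow_one]
          apply le_of_eq
          have : ‖ξ‖ ^ (1 / 2 : ℝ) * ‖ξ‖ ^ (1 / 2 : ℝ) / ‖ξ‖ = 1 := by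
            rw [hs, div_self hpos.ne']
          calc _ = 4 * V * C * ‖ξ‖ * (‖ξ‖ ^ (1 / 2 : ℝ) * ‖ξ‖ ^ (1 / 2 : ℝ) / ‖ξ‖) := by ring
            _ = _ := by rw [this]; ring
        · positivity
        · exact (integrableOn_Ioi_rpow_of_lt (by norm_num) hpos).const_mul _
        · filter_upwards [ae_restrict_mem measurableSet_Ioi] with l hl
          have : 0 < l := hpos.trans hl
          positivity
      refine (lintegral_mono_ae hb).trans_lt ?_
      rw [lintegral_const_mul' _ _ ENNReal.ofReal_ne_top]
      exact ENNReal.mul_lt_top ENNReal.ofReal_lt_top hv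
    · rw [lintegral_lintegral_swap hG2.aemeasurable]
      have hb : ∀ ξ : E, ∫⁻ l in Set.Ioi 0, G2 l ξ ≤ 2 * (ENNReal.ofReal ‖ξ‖ * ‖h ξ‖ₑ ^ 2) := by
        intro ξ
        have e1 : ∀ l, G2 l ξ = (Set.Iic ‖ξ‖).indicator (fun _ => 2 * ‖h ξ‖ₑ ^ 2) l := by
          intro l
          simp only [G2, Set.indicator, mem_ball_zero_iff, Set.mem_Iic, Set.mem_compl_iff, not_lt]
        simp_rw [e1]
        rw [lintegral_indicator measurableSet_Iic, Measure.restrict_restrict measurableSet_Iic,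
          Set.Iic_inter_Ioi, setLIntegral_const, Real.volume_Ioc, sub_zero]
        apply le_of_eq; ring
      refine (lintegral_mono hb).trans_lt ?_
      rw [lintegral_const_mul' _ _ (by simp)]
      exact ENNReal.mul_lt_top (by simp) hv
  · intro l hl y
    obtain ⟨b, hbm, hb, hvb⟩ := hsplit l
    have hball : MeasurableSet (Metric.ball (0 : E) l) := Metric.isOpen_ball.measurableSet
    have hvol : volume (Metric.ball y l⁻¹) =
        ENNReal.ofReal (V * l ^ (-(Module.finrank ℝ E : ℝ))) := by
      rw [Measure.addHaar_ball _ _ (by positivity), ENNReal.ofReal_mul hV0, hV, mul_comm,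
        Real.rpow_neg hl.le, Real.rpow_natCast, inv_pow]
    calc ∫⁻ x in Metric.ball y l⁻¹, ‖v x‖ₑ ^ 2
        ≤ ∫⁻ x in Metric.ball y l⁻¹,
          (2 * (∫⁻ ξ in Metric.ball (0 : E) l, ‖h ξ‖ₑ) ^ 2 + 2 * ‖b x‖ₑ ^ 2) := by
          apply lintegral_mono_ae
          filter_upwards [ae_restrict_of_ae hvb] with x hx
          exact (pow_le_pow_left₀ (by positivity) hx 2).trans (ennreal_add_sq_le _ _)
      _ = 2 * (∫⁻ ξ in Metric.ball (0 : E) l, ‖h ξ‖ₑ) ^ 2 * volume (Metric.ball y l⁻¹) +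
          2 * ∫⁻ x in Metric.ball y l⁻¹, ‖b x‖ₑ ^ 2 := by
          rw [lintegral_add_left measurable_const, setLIntegral_const,
            lintegral_const_mul' _ _ (by simp)]
      _ ≤ 2 * (ENNReal.ofReal (C * l ^ (Module.finrank ℝ E - (3 / 2) : ℝ)) *
            ∫⁻ ξ in Metric.ball (0 : E) l, w ξ) * volume (Metric.ball y l⁻¹) +
          2 * ∫⁻ x, ‖b x‖ₑ ^ 2 := by
          gcongr
          · exact hCS l hl h hhm.aestronglyMeasurable
          · exact Measure.restrict_le_self
      _ = _ := by
          have e2 : ∫⁻ ξ, G2 l ξ = 2 * ∫⁻ x, ‖b x‖ₑ ^ 2 := by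
            simp only [G2]
            rw [lintegral_indicator hball.compl, lintegral_const_mul' _ _ (by simp), hb]
          have e1 : ∫⁻ ξ, G1 l ξ = ENNReal.ofReal (2 * V * C * l ^ (-(3 / 2) : ℝ)) *
              ∫⁻ ξ in Metric.ball (0 : E) l, w ξ := by
            simp only [G1]
            rw [lintegral_indicator hball, lintegral_const_mul' _ _ ENNReal.ofReal_ne_top]
          simp only
          rw [e1, e2, hvol]
          congr 1
          have : 2 * V * C * l ^ (-(3 / 2) : ℝ) =
              2 * (C * l ^ (Module.finrank ℝ E - (3 / 2) : ℝ)) *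
                (V * l ^ (-(Module.finrank ℝ E : ℝ))) := by
            have : l ^ (-(3 / 2) : ℝ) = l ^ (Module.finrank ℝ E - (3 / 2) : ℝ) *
                l ^ (-(Module.finrank ℝ E : ℝ)) := by
              rw [← Real.rpow_add hl]; ring_nf
            rw [this]; ring
          have hA : 0 ≤ C * l ^ (Module.finrank ℝ E - (3 / 2) : ℝ) := by positivity
          rw [this]
          generalize C * l ^ (Module.finrank ℝ E - (3 / 2) : ℝ) = A at hA ⊢
          rw [ENNReal.ofReal_mul (p := 2 * A) (by positivity),
            ENNReal.ofReal_mul (p := 2) (q := A) (by norm_num),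
            ENNReal.ofReal_ofNat]
          ring

/-- Weak-type form of the critical Sobolev embedding of `H^{1/2}`. -/
theorem exists_meas_lt_le (hd : 2 ≤ Module.finrank ℝ E)
    (v : Lp ℂ 2 (volume : Measure E))
    (hv : ∫⁻ ξ, ENNReal.ofReal ‖ξ‖ * ‖𝓕 v ξ‖ₑ ^ 2 < ∞) :
    ∃ C : ℝ, ∀ t : ℝ, 0 < t → volume {x | t < ‖v x‖} ≤
      ENNReal.ofReal (C * t ^ (-(2 * Module.finrank ℝ E / (Module.finrank ℝ E - 1)) : ℝ)) := by
  have hd' : (2 : ℝ) ≤ Module.finrank ℝ E := by exact_mod_cast hd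
  obtain ⟨C, hC, hCS⟩ := lintegral_ball_enorm_sq_le (E := E) (a := 1) (by omega) (by linarith)
  obtain ⟨h, hh⟩ : ∃ h : Lp ℂ 2 (volume : Measure E), h = 𝓕 v := ⟨_, rfl⟩
  have hsplit := exists_frequency_splitting v
  simp only [← hh] at hv hsplit
  set d : ℝ := (Module.finrank ℝ E : ℝ)
  set I := ∫⁻ ξ, ENNReal.ofReal ‖ξ‖ * ‖h ξ‖ₑ ^ 2
  set W := I.toReal + 1
  have hW : 0 < W := by have : 0 ≤ I.toReal := ENNReal.toReal_nonneg; linarith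
  have hIW : I ≤ ENNReal.ofReal W := by
    rw [← ENNReal.ofReal_toReal hv.ne]
    exact ENNReal.ofReal_le_ofReal (by simp [W])
  have hd1 : 0 < d - 1 := by linarith
  refine ⟨4 * W * (4 * C * W) ^ (1 / (d - 1)), fun t ht => ?_⟩
  -- the frequency at which the low part is at most `t / 2`
  set A := (t ^ 2 / (4 * C * W)) ^ (1 / (d - 1)) with hA
  have hA0 : 0 < A := by positivity
  have hAd : C * A ^ (d - 1) * W = (t / 2) ^ 2 := by
    rw [hA, ← Real.rpow_mul (by positivity), one_div_mul_cancel hd1.ne', Real.rpow_one]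
    field_simp; norm_num
  obtain ⟨b, hbm, hb, hvb⟩ := hsplit A
  have hlow : ∫⁻ ξ in Metric.ball (0 : E) A, ‖h ξ‖ₑ ≤ ENNReal.ofReal (t / 2) := by
    rw [← ENNReal.pow_le_pow_left_iff (n := 2) (by norm_num), ← ENNReal.ofReal_pow (by positivity),
      ← hAd, ENNReal.ofReal_mul (by positivity)]
    refine (hCS A hA0 h (Lp.aestronglyMeasurable h)).trans ?_
    gcongr
    refine le_trans ?_ hIW
    simp only [Real.rpow_one]
    exact lintegral_mono' Measure.restrict_le_self le_rfl
  have hhigh : ENNReal.ofReal A * ∫⁻ x, ‖b x‖ₑ ^ 2 ≤ ENNReal.ofReal W := by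
    rw [hb, ← lintegral_const_mul' _ _ ENNReal.ofReal_ne_top]
    refine le_trans ?_ hIW
    refine le_trans ?_ (setLIntegral_le_lintegral (Metric.ball (0 : E) A)ᶜ _)
    refine setLIntegral_mono' Metric.isOpen_ball.measurableSet.compl fun ξ hξ => ?_
    gcongr
    simpa using hξ
  have hsub : volume {x | t < ‖v x‖} ≤ volume {x | ENNReal.ofReal ((t / 2) ^ 2) ≤ ‖b x‖ₑ ^ 2} := by
    apply measure_mono_ae
    filter_upwards [hvb] with x hx
    intro (hxt : t < ‖v x‖)
    change ENNReal.ofReal ((t / 2) ^ 2) ≤ ‖b x‖ₑ ^ 2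
    have h1 := hx.trans (add_le_add_left hlow _)
    rw [← ofReal_norm, ← ofReal_norm, ← ENNReal.ofReal_add (by positivity) (by positivity),
      ENNReal.ofReal_le_ofReal_iff (by positivity)] at h1
    rw [← ofReal_norm, ← ENNReal.ofReal_pow (by positivity)]
    apply ENNReal.ofReal_le_ofReal
    apply pow_le_pow_left₀ (by positivity)
    linarith
  have hcheb := mul_meas_ge_le_lintegral₀ (μ := (volume : Measure E)) (f := fun x => ‖b x‖ₑ ^ 2)
    (hbm.enorm.pow_const _) (ENNReal.ofReal ((t / 2) ^ 2))
  have hall : ENNReal.ofReal (A * (t / 2) ^ 2) * volume {x | t < ‖v x‖} ≤ ENNReal.ofReal W := by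
    rw [ENNReal.ofReal_mul hA0.le, mul_assoc]
    refine le_trans ?_ hhigh
    gcongr
    exact (mul_le_mul_right hsub _).trans hcheb
  have hfin : ENNReal.ofReal (A * (t / 2) ^ 2) ≠ 0 := by
    rw [Ne, ENNReal.ofReal_eq_zero, not_le]; positivity
  have := (ENNReal.le_div_iff_mul_le (Or.inl hfin) (Or.inl ENNReal.ofReal_ne_top)).2
    ((mul_comm _ _).trans_le hall)
  refine this.trans (le_of_eq ?_)
  rw [← ENNReal.ofReal_div_of_pos (by positivity)]
  congr 1
  rw [hA, Real.div_rpow (by positivity) (by positivity)]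
  have e : t ^ (-(2 * d / (d - 1))) = (t ^ 2)⁻¹ * ((t ^ 2) ^ (1 / (d - 1)))⁻¹ := by
    rw [← Real.rpow_natCast t 2, ← Real.rpow_mul ht.le, ← mul_inv, ← Real.rpow_add ht,
      ← Real.rpow_neg ht.le]
    congr 1
    push_cast
    field_simp
    ring
  rw [e]
  field_simp
  norm_num

/-- Subcritical Sobolev embedding of `H^{1/2}`. -/
theorem lintegral_rpow_lt_top (hd : 2 ≤ Module.finrank ℝ E)
    (v : Lp ℂ 2 (volume : Measure E))
    (hv : ∫⁻ ξ, ENNReal.ofReal ‖ξ‖ * ‖𝓕 v ξ‖ₑ ^ 2 < ∞) {r : ℝ} (hr : 2 < r)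
    (hr' : r < 2 * Module.finrank ℝ E / (Module.finrank ℝ E - 1)) :
    ∫⁻ x, ENNReal.ofReal (‖v x‖ ^ r) < ∞ := by
  obtain ⟨C, hC⟩ := exists_meas_lt_le hd v hv
  set d : ℝ := (Module.finrank ℝ E : ℝ)
  have hvm := (Lp.aestronglyMeasurable v).norm.aemeasurable
  rw [lintegral_rpow_eq_lintegral_meas_lt_mul _ (Eventually.of_forall fun x => norm_nonneg _) hvm
    (by linarith)]
  refine ENNReal.mul_lt_top ENNReal.ofReal_lt_top ?_
  rw [← Set.Ioc_union_Ioi_eq_Ioi (zero_le_one (α := ℝ)), lintegral_union measurableSet_Ioi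
    (Set.disjoint_left.2 fun x hx hx' => not_lt.2 hx.2 hx')]
  set M := ‖v‖ ^ 2
  have hcheb : ∀ t : ℝ, 0 < t → volume {x | t < ‖v x‖} ≤ ENNReal.ofReal (M * t ^ (-2 : ℝ)) := by
    intro t ht
    have h1 := mul_meas_ge_le_lintegral₀ (μ := (volume : Measure E)) (f := fun x => ‖v x‖ₑ ^ 2)
      ((Lp.aestronglyMeasurable v).enorm.pow_const _) (ENNReal.ofReal (t ^ 2))
    rw [lintegral_enorm_sq_eq, ← ofReal_norm, ← ENNReal.ofReal_pow (norm_nonneg _)] at h1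
    have h0 : ENNReal.ofReal (t ^ 2) ≠ 0 := by rw [Ne, ENNReal.ofReal_eq_zero, not_le]; positivity
    have h2 := (ENNReal.le_div_iff_mul_le (Or.inl h0) (Or.inl ENNReal.ofReal_ne_top)).2
      ((mul_comm _ _).trans_le h1)
    rw [← ENNReal.ofReal_div_of_pos (by positivity)] at h2
    have h3 : M * t ^ (-2 : ℝ) = ‖v‖ ^ 2 / t ^ 2 := by
      rw [Real.rpow_neg ht.le]; norm_num; rfl
    rw [h3]
    refine (measure_mono fun x hx => ?_).trans h2
    change ENNReal.ofReal (t ^ 2) ≤ ‖v x‖ₑ ^ 2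
    rw [← ofReal_norm, ← ENNReal.ofReal_pow (norm_nonneg _)]
    exact ENNReal.ofReal_le_ofReal (pow_le_pow_left₀ ht.le (le_of_lt hx) 2)
  -- small levels are controlled by the `L²` norm, large ones by the weak critical estimate
  rw [ENNReal.add_lt_top]
  constructor
  · refine (setLIntegral_mono' measurableSet_Ioc (g := fun t => ENNReal.ofReal (M * t ^ (r - 3)))
      fun t ht => ?_).trans_lt ?_
    · refine (mul_le_mul_left (hcheb t ht.1) _).trans (le_of_eq ?_)
      rw [← ENNReal.ofReal_mul (by have := ht.1; positivity), mul_assoc, ← Real.rpow_add ht.1]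
      ring_nf
    · refine IntegrableOn.setLIntegral_lt_top (Integrable.const_mul ?_ _)
      have := (intervalIntegral.intervalIntegrable_rpow' (a := 0) (b := 1) (r := r - 3)
        (by linarith))
      exact (intervalIntegrable_iff_integrableOn_Ioc_of_le zero_le_one).1 this
  · refine (setLIntegral_mono' measurableSet_Ioi (g := fun t => ENNReal.ofReal
      (|C| * t ^ (r - 1 - 2 * d / (d - 1)))) fun t ht => ?_).trans_lt ?_
    · have ht0 : 0 < t := zero_lt_one.trans ht
      refine (mul_le_mul_left (hC t ht0) _).trans ?_
      rw [← ENNReal.ofReal_mul' (by positivity), mul_assoc, ← Real.rpow_add ht0]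
      apply ENNReal.ofReal_le_ofReal
      rw [neg_add_eq_sub]
      gcongr
      exact le_abs_self C
    · refine IntegrableOn.setLIntegral_lt_top (Integrable.const_mul ?_ _)
      exact integrableOn_Ioi_rpow_of_lt (by linarith) zero_lt_one

end HalfDerivative

/-! ### Hardy weight and the space `H^{1/2}` -/

section Hardy

variable {E : Type*} [NormedAddCommGroup E] [InnerProductSpace ℝ E] [FiniteDimensional ℝ E]
  [MeasurableSpace E] [BorelSpace E]

/-- Layer-cake formula for the weight `1/|x|`. -/
theorem lintegral_mul_inv_norm [Nontrivial E] {φ : E → ℝ≥0∞} (hφ : Measurable φ) :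
    ∫⁻ x, φ x * ENNReal.ofReal ‖x‖⁻¹ =
      ∫⁻ l in Set.Ioi (0 : ℝ), ∫⁻ x in Metric.ball (0 : E) l⁻¹, φ x := by
  let G : ℝ → E → ℝ≥0∞ := fun l x => (Metric.ball (0 : E) l⁻¹).indicator φ x
  have hG : Measurable (Function.uncurry G) := by
    have : Function.uncurry G = {p : ℝ × E | ‖p.2‖ < p.1⁻¹}.indicator (fun p => φ p.2) := by
      ext p
      simp only [Function.uncurry, G, Set.indicator, mem_ball_zero_iff, Set.mem_ofPred_eq]
    rw [this]
    exact (hφ.comp measurable_snd).indicator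
      (measurableSet_lt (measurable_norm.comp measurable_snd) measurable_fst.inv)
  have h1 : ∫⁻ l in Set.Ioi (0 : ℝ), ∫⁻ x in Metric.ball (0 : E) l⁻¹, φ x =
      ∫⁻ l in Set.Ioi (0 : ℝ), ∫⁻ x, G l x := by
    congr with l
    rw [lintegral_indicator Metric.isOpen_ball.measurableSet]
  rw [h1, lintegral_lintegral_swap hG.aemeasurable]
  apply lintegral_congr_ae
  have hne : ∀ᵐ x : E, x ≠ 0 := by simp [ae_iff]
  filter_upwards [hne] with x hx
  have hpos : 0 < ‖x‖ := norm_pos_iff.2 hx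
  have h2 : ∫⁻ l in Set.Ioi (0 : ℝ), G l x =
      ∫⁻ l in Set.Ioi (0 : ℝ), (Set.Iio ‖x‖⁻¹).indicator (fun _ => φ x) l := by
    refine setLIntegral_congr_fun measurableSet_Ioi fun l hl => ?_
    simp only [G, Set.indicator, mem_ball_zero_iff, Set.mem_Iio]
    congr 1
    rw [lt_inv_comm₀ hpos hl]
  rw [h2, lintegral_indicator measurableSet_Iio, Measure.restrict_restrict measurableSet_Iio,
    Set.Iio_inter_Ioi, setLIntegral_const, Real.volume_Ioo, sub_zero]

theorem setLIntegral_ball_comp_add (φ : E → ℝ≥0∞) (a : E) (r : ℝ) :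
    ∫⁻ x in Metric.ball (0 : E) r, φ (x + a) = ∫⁻ x in Metric.ball a r, φ x := by
  rw [← lintegral_indicator Metric.isOpen_ball.measurableSet,
    ← lintegral_indicator Metric.isOpen_ball.measurableSet,
    ← lintegral_add_right_eq_self ((Metric.ball a r).indicator φ) a]
  congr with x
  simp [Set.indicator]

/-- Hardy's inequality for translates, in qualitative form. -/
theorem lintegral_mul_inv_norm_lt_top (hd : 2 ≤ Module.finrank ℝ E)
    (v : Lp ℂ 2 (volume : Measure E))
    (hv : ∫⁻ ξ, ENNReal.ofReal ‖ξ‖ * ‖𝓕 v ξ‖ₑ ^ 2 < ∞) :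
    ∫⁻ x, ‖v x‖ₑ ^ 2 * ENNReal.ofReal ‖x‖⁻¹ < ∞ := by
  have : Nontrivial E := Module.nontrivial_of_finrank_pos (R := ℝ) (by omega)
  obtain ⟨g, hg, hb⟩ := exists_integrable_bound_ball hd v hv
  rw [lintegral_mul_inv_norm ((Lp.stronglyMeasurable v).measurable.enorm.pow_const _)]
  exact (setLIntegral_mono' measurableSet_Ioi fun l hl => hb l hl 0).trans_lt hg

/-- The Coulomb energy of a translate tends to zero as the translation goes to infinity: by
`exists_integrable_bound_ball` the masses on balls have a majorant independent of the centre. -/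
theorem tendsto_lintegral_mul_inv_norm (hd : 2 ≤ Module.finrank ℝ E)
    (v : Lp ℂ 2 (volume : Measure E))
    (hv : ∫⁻ ξ, ENNReal.ofReal ‖ξ‖ * ‖𝓕 v ξ‖ₑ ^ 2 < ∞) {a : ℕ → E}
    (ha : Tendsto (fun n => ‖a n‖) atTop atTop) :
    Tendsto (fun n => ∫⁻ x, ‖v (x + a n)‖ₑ ^ 2 * ENNReal.ofReal ‖x‖⁻¹) atTop (𝓝 0) := by
  have : Nontrivial E := Module.nontrivial_of_finrank_pos (R := ℝ) (by omega)
  obtain ⟨g, hg, hb⟩ := exists_integrable_bound_ball hd v hv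
  have hvm : Measurable fun x => ‖v x‖ₑ ^ 2 :=
    (Lp.stronglyMeasurable v).measurable.enorm.pow_const _
  have hφ : ∀ n, Measurable fun x => ‖v (x + a n)‖ₑ ^ 2 := fun n =>
    hvm.comp (measurable_add_const (a n))
  have e : ∀ n, ∫⁻ x, ‖v (x + a n)‖ₑ ^ 2 * ENNReal.ofReal ‖x‖⁻¹ =
      ∫⁻ l in Set.Ioi (0 : ℝ), ∫⁻ x in Metric.ball (a n) l⁻¹, ‖v x‖ₑ ^ 2 := by
    intro n
    rw [lintegral_mul_inv_norm (hφ n)]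
    congr with l
    exact setLIntegral_ball_comp_add (fun x => ‖v x‖ₑ ^ 2) (a n) l⁻¹
  simp_rw [e]
  have hz : (0 : ℝ≥0∞) = ∫⁻ l in Set.Ioi (0 : ℝ), 0 := by simp
  rw [hz]
  refine tendsto_lintegral_of_dominated_convergence' g ?_ ?_ hg.ne ?_
  · intro n
    have hG : Measurable (Function.uncurry fun (l : ℝ) (x : E) =>
        (Metric.ball (a n) l⁻¹).indicator (fun x => ‖v x‖ₑ ^ 2) x) := by
      have : (Function.uncurry fun (l : ℝ) (x : E) =>
        (Metric.ball (a n) l⁻¹).indicator (fun x => ‖v x‖ₑ ^ 2) x) =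
          {p : ℝ × E | dist p.2 (a n) < p.1⁻¹}.indicator (fun p => ‖v p.2‖ₑ ^ 2) := by
        ext p
        simp only [Function.uncurry, Set.indicator, Metric.mem_ball, Set.mem_ofPred_eq]
      rw [this]
      exact (hvm.comp measurable_snd).indicator
        (measurableSet_lt (measurable_snd.dist measurable_const) measurable_fst.inv)
    have := hG.lintegral_prod_right' (ν := (volume : Measure E))
    refine this.aemeasurable.congr (Eventually.of_forall fun l => ?_)
    exact lintegral_indicator (Metric.isOpen_ball (x := a n) (ε := l⁻¹)).measurableSet _
  · intro n
    filter_upwards [ae_restrict_mem measurableSet_Ioi] with l hl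
    exact hb l hl (a n)
  · refine Eventually.of_forall fun l => ?_
    have e2 : ∀ n, ∫⁻ x in Metric.ball (a n) l⁻¹, ‖v x‖ₑ ^ 2 =
        ∫⁻ x, (Metric.ball (a n) l⁻¹).indicator (fun x => ‖v x‖ₑ ^ 2) x := fun n =>
      (lintegral_indicator Metric.isOpen_ball.measurableSet _).symm
    simp_rw [e2]
    rw [← lintegral_zero (μ := (volume : Measure E))]
    refine tendsto_lintegral_of_dominated_convergence (fun x => ‖v x‖ₑ ^ 2)
      (fun n => hvm.indicator Metric.isOpen_ball.measurableSet)
      (fun n => Eventually.of_forall fun x => Set.indicator_le_self _ _ _) ?_ ?_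
    · rw [lintegral_enorm_sq_eq]; simp
    · refine Eventually.of_forall fun x => tendsto_const_nhds.congr' ?_
      filter_upwards [ha.eventually_ge_atTop (‖x‖ + l⁻¹)] with n hn
      symm
      apply Set.indicator_of_notMem
      rw [Metric.mem_ball, not_lt, dist_comm, dist_eq_norm]
      have := norm_sub_norm_le (a n) x
      linarith

end Hardy

section H12

variable {N : ℕ}

theorem coeFn_complexify (u : L2 N) : complexify u =ᵐ[volume] fun x => (u x : ℂ) :=
  ContinuousLinearMap.coeFn_compLp _ _

theorem complexify_smul (t : ℝ) (u : L2 N) : complexify (t • u) = (t : ℂ) • complexify u := by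
  apply Lp.ext
  filter_upwards [coeFn_complexify (t • u), Lp.coeFn_smul (t : ℂ) (complexify u),
    coeFn_complexify u, Lp.coeFn_smul t u] with x h1 h2 h3 h4
  rw [h1, h2, Pi.smul_apply, h3, h4]; simp

theorem complexify_shift (a : Space N) (u : L2 N) :
    complexify (shift a u) = shift a (complexify u) := by
  apply Lp.ext
  filter_upwards [coeFn_complexify (shift a u), coeFn_shift a (complexify u), coeFn_shift a u,
    (measurePreserving_add_right (volume : Measure (Space N)) a).quasiMeasurePreserving.ae
      (coeFn_complexify u)] with x h1 h2 h3 h4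
  rw [h1, h2, h3, h4]

theorem hat_smul (t : ℝ) (u : L2 N) : hat (t • u) =ᵐ[volume] fun ξ => (t : ℂ) * hat u ξ := by
  have : hat (t • u) = (t : ℂ) • hat u := by
    rw [hat, complexify_smul, FourierTransform.fourier_smul]; rfl
  rw [this]
  filter_upwards [Lp.coeFn_smul (t : ℂ) (hat u)] with ξ h
  rw [h]; rfl

theorem norm_hat_shift (a : Space N) (u : L2 N) :
    ∀ᵐ ξ, ‖hat (shift a u) ξ‖ = ‖hat u ξ‖ := by
  rw [hat, complexify_shift]
  exact norm_fourier_shift a (complexify u)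

/-- The Bessel weight `(1 + |ξ|²)^{1/2}` in the definition of `H^{1/2}` is comparable with
`1 + |ξ|`. -/
theorem mem_H12_iff {u : L2 N} :
    u ∈ H12 N ↔ Integrable (fun ξ => (1 + ‖ξ‖) * ‖hat u ξ‖ ^ 2) volume := by
  have h1 : u ∈ H12 N ↔ MemLp (fun ξ => (((1 + ‖ξ‖ ^ 2) ^ ((1 / 2 : ℝ) / 2) : ℝ) : ℂ) * hat u ξ)
      2 volume := by
    rw [← exists_smulLeftCLM_eq_iff (by fun_prop)]
    change TemperedDistribution.MemSobolev (1 / 2) 2 _ ↔ _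
    rw [TemperedDistribution.memSobolev_iff_exists_smulLeftCLM_fourier,
      Lp.fourier_toTemperedDistribution_eq]
    rfl
  have hm : AEStronglyMeasurable (hat u) volume := Lp.aestronglyMeasurable _
  have hm' : AEStronglyMeasurable
      (fun ξ => (((1 + ‖ξ‖ ^ 2) ^ ((1 / 2 : ℝ) / 2) : ℝ) : ℂ) * hat u ξ) volume := by
    refine AEStronglyMeasurable.mul (Continuous.aestronglyMeasurable ?_) hm
    refine Complex.continuous_ofReal.comp ((by fun_prop : Continuous fun ξ : Space N =>
      1 + ‖ξ‖ ^ 2).rpow_const fun ξ => Or.inl (by positivity))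
  have e : ∀ ξ, ‖(((1 + ‖ξ‖ ^ 2) ^ ((1 / 2 : ℝ) / 2) : ℝ) : ℂ) * hat u ξ‖ ^ 2 =
      √(1 + ‖ξ‖ ^ 2) * ‖hat u ξ‖ ^ 2 := by
    intro ξ
    rw [norm_mul, mul_pow, Complex.norm_real, Real.norm_of_nonneg (by positivity),
      ← Real.rpow_natCast, ← Real.rpow_mul (by positivity), Real.sqrt_eq_rpow]
    norm_num
  rw [h1, ← integrable_norm_rpow_iff hm' (by norm_num) (by norm_num)]
  simp only [ENNReal.toReal_ofNat, Real.rpow_two, e]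
  constructor
  · intro h
    refine (h.const_mul 2).mono' (by fun_prop) (Eventually.of_forall fun ξ => ?_)
    rw [Real.norm_of_nonneg (by positivity), ← mul_assoc]
    gcongr
    rw [show (2 : ℝ) * √(1 + ‖ξ‖ ^ 2) = √(1 + ‖ξ‖ ^ 2) + √(1 + ‖ξ‖ ^ 2) by ring]
    gcongr
    · exact Real.one_le_sqrt.2 (by nlinarith [norm_nonneg ξ])
    · exact Real.le_sqrt_of_sq_le (by linarith)
  · intro h
    refine h.mono' (by fun_prop) (Eventually.of_forall fun ξ => ?_)
    rw [Real.norm_of_nonneg (by positivity)]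
    gcongr
    exact Real.sqrt_le_iff.2 ⟨by positivity, by nlinarith [norm_nonneg ξ]⟩

theorem smul_mem_H12 {u : L2 N} (hu : u ∈ H12 N) (t : ℝ) : t • u ∈ H12 N := by
  rw [mem_H12_iff] at hu ⊢
  refine (hu.const_mul (t ^ 2)).congr ?_
  filter_upwards [hat_smul t u] with ξ h
  rw [h, norm_mul, Complex.norm_real, mul_pow, Real.norm_eq_abs, sq_abs]; ring

theorem shift_mem_H12 {u : L2 N} (hu : u ∈ H12 N) (a : Space N) : shift a u ∈ H12 N := by
  rw [mem_H12_iff] at hu ⊢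
  refine hu.congr ?_
  filter_upwards [norm_hat_shift a u] with ξ h
  rw [h]

theorem lintegral_hat_lt_top {u : L2 N} (hu : u ∈ H12 N) :
    ∫⁻ ξ, ENNReal.ofReal ‖ξ‖ * ‖𝓕 (complexify u) ξ‖ₑ ^ 2 < ∞ := by
  refine lt_of_le_of_lt (lintegral_mono fun ξ => ?_) (mem_H12_iff.1 hu).lintegral_lt_top
  rw [ENNReal.ofReal_mul (by positivity), ENNReal.ofReal_pow (norm_nonneg _), ofReal_norm (hat u ξ)]
  have : ‖ξ‖ ≤ 1 + ‖ξ‖ := by linarith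
  exact mul_le_mul_left (ENNReal.ofReal_le_ofReal this) _

/-- The subcritical Sobolev embedding for real-valued functions. -/
theorem integrable_abs_rpow (hN : 2 ≤ N) {u : L2 N} (hu : u ∈ H12 N) {r : ℝ} (hr : 2 < r)
    (hr' : r < 2 * N / ((N : ℝ) - 1)) : Integrable (fun x => |u x| ^ r) volume := by
  have h := lintegral_rpow_lt_top (E := Space N) (by simpa using hN) (complexify u)
    (lintegral_hat_lt_top hu) hr (by simpa using hr')
  refine ⟨((Lp.stronglyMeasurable u).measurable.abs.pow_const r).aestronglyMeasurable, ?_⟩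
  rw [hasFiniteIntegral_iff_ofReal (Eventually.of_forall fun x => by positivity)]
  refine lt_of_le_of_lt (le_of_eq (lintegral_congr_ae ?_)) h
  filter_upwards [coeFn_complexify u] with x hx
  rw [hx, Complex.norm_real, Real.norm_eq_abs]

theorem integrable_sq (u : L2 N) : Integrable (fun x => u x ^ 2) volume :=
  (Lp.memLp u).integrable_sq

theorem ofReal_sq_div_norm (u : L2 N) : ∀ᵐ x, ENNReal.ofReal (u x ^ 2 / ‖x‖) =
    ‖complexify u x‖ₑ ^ 2 * ENNReal.ofReal ‖x‖⁻¹ := by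
  filter_upwards [coeFn_complexify u] with x hx
  rw [hx, div_eq_mul_inv, ENNReal.ofReal_mul (sq_nonneg _), ← ofReal_norm, Complex.norm_real,
    ← ENNReal.ofReal_pow (norm_nonneg _), Real.norm_eq_abs, sq_abs]

theorem integrable_sq_div_norm (hN : 2 ≤ N) {u : L2 N} (hu : u ∈ H12 N) :
    Integrable (fun x => u x ^ 2 / ‖x‖) volume := by
  have h := lintegral_mul_inv_norm_lt_top (E := Space N) (by simpa using hN) (complexify u)
    (lintegral_hat_lt_top hu)
  refine ⟨(((Lp.stronglyMeasurable u).measurable.pow_const 2).div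
    measurable_norm).aestronglyMeasurable, ?_⟩
  rw [hasFiniteIntegral_iff_ofReal (Eventually.of_forall fun x => by positivity)]
  exact lt_of_le_of_lt (le_of_eq (lintegral_congr_ae (ofReal_sq_div_norm u))) h

theorem tendsto_integral_shift_sq_div_norm (hN : 2 ≤ N) {u : L2 N} (hu : u ∈ H12 N)
    {a : ℕ → Space N} (ha : Tendsto (fun n => ‖a n‖) atTop atTop) :
    Tendsto (fun n => ∫ x, (shift (a n) u) x ^ 2 / ‖x‖) atTop (𝓝 0) := by
  have h := tendsto_lintegral_mul_inv_norm (E := Space N) (by simpa using hN) (complexify u)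
    (lintegral_hat_lt_top hu) ha
  have e : ∀ n, ∫ x, (shift (a n) u) x ^ 2 / ‖x‖ =
      (∫⁻ x, ‖complexify u (x + a n)‖ₑ ^ 2 * ENNReal.ofReal ‖x‖⁻¹).toReal := by
    intro n
    rw [integral_eq_lintegral_of_nonneg_ae (Eventually.of_forall fun x => by positivity)
      (integrable_sq_div_norm hN (shift_mem_H12 hu _)).aestronglyMeasurable,
      lintegral_congr_ae (ofReal_sq_div_norm _), complexify_shift]
    congr 1
    apply lintegral_congr_ae
    filter_upwards [coeFn_shift (a n) (complexify u)] with x hx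
    rw [hx]
  simp_rw [e]
  have := (ENNReal.tendsto_toReal ENNReal.zero_ne_top).comp h
  rwa [ENNReal.toReal_zero] at this

end H12

/-! ### Finiteness of the Riesz energy -/

section RieszPotential

variable {E : Type*} [NormedAddCommGroup E] [InnerProductSpace ℝ E] [FiniteDimensional ℝ E]
  [MeasurableSpace E] [BorelSpace E]

/-- Pointwise form of Young's convolution inequality: the weighted inequality between geometric and
arithmetic means, with weights `2/s - 1`, `1 - 1/s` and `1 - 1/s`. -/
theorem mul_rpow_neg_le_add {a b r β s : ℝ} (ha : 0 ≤ a) (hb : 0 ≤ b) (hr : 0 < r)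
    (hs : 1 < s) (hs2 : s < 2) :
    a * b * r ^ (-β) ≤ a ^ s * b ^ s + a ^ s * r ^ (-(β * s / (2 * (s - 1))))
      + b ^ s * r ^ (-(β * s / (2 * (s - 1)))) := by
  have hs0 : 0 < s := by linarith
  set k := r ^ (-(β * s / (2 * (s - 1))))
  have hk : 0 < k := Real.rpow_pos_of_pos hr _
  have hw1 : 0 ≤ 2 / s - 1 := by rw [sub_nonneg, le_div_iff₀ hs0]; linarith
  have hw2 : 0 ≤ 1 - 1 / s := by rw [sub_nonneg, div_le_iff₀ hs0]; linarith
  have has : 0 ≤ a ^ s := Real.rpow_nonneg ha s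
  have hbs : 0 ≤ b ^ s := Real.rpow_nonneg hb s
  have key := Real.geom_mean_le_arith_mean3_weighted hw1 hw2 hw2
    (mul_nonneg has hbs) (mul_nonneg has hk.le) (mul_nonneg hbs hk.le) (by ring)
  have h1 : ∀ c : ℝ, 0 ≤ c → (c ^ s) ^ (2 / s - 1) * (c ^ s) ^ (1 - 1 / s) = c := by
    intro c hc
    rw [← Real.rpow_mul hc, ← Real.rpow_mul hc]
    rcases hc.eq_or_lt with rfl | hc
    · have e1 : s * (2 / s - 1) = 2 - s := by field_simp
      rw [e1, Real.zero_rpow (by linarith), zero_mul]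
    · rw [← Real.rpow_add hc]
      have : s * (2 / s - 1) + s * (1 - 1 / s) = 1 := by field_simp; ring
      rw [this, Real.rpow_one]
  have h2 : k ^ (1 - 1 / s) * k ^ (1 - 1 / s) = r ^ (-β) := by
    rw [← Real.rpow_mul hr.le, ← Real.rpow_add hr]
    congr 1
    have : s - 1 ≠ 0 := by linarith
    field_simp
    ring
  rw [Real.mul_rpow has hbs, Real.mul_rpow has hk.le, Real.mul_rpow hbs hk.le] at key
  have e : a * b * r ^ (-β) = (a ^ s) ^ (2 / s - 1) * (b ^ s) ^ (2 / s - 1) *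
      ((a ^ s) ^ (1 - 1 / s) * k ^ (1 - 1 / s)) * ((b ^ s) ^ (1 - 1 / s) * k ^ (1 - 1 / s)) := by
    calc _ = ((a ^ s) ^ (2 / s - 1) * (a ^ s) ^ (1 - 1 / s)) *
          ((b ^ s) ^ (2 / s - 1) * (b ^ s) ^ (1 - 1 / s)) *
          (k ^ (1 - 1 / s) * k ^ (1 - 1 / s)) := by rw [h1 a ha, h1 b hb, h2]
      _ = _ := by ring
  rw [e]
  refine key.trans ?_
  have hw1' : 2 / s - 1 ≤ 1 := by
    have : 2 / s ≤ 2 := by rw [div_le_iff₀ hs0]; linarith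
    linarith
  have hw2' : 1 - 1 / s ≤ 1 := by
    have : 0 ≤ 1 / s := by positivity
    linarith
  have p1 := mul_le_of_le_one_left (mul_nonneg has hbs) hw1'
  have p2 := mul_le_of_le_one_left (mul_nonneg has hk.le) hw2'
  have p3 := mul_le_of_le_one_left (mul_nonneg hbs hk.le) hw2'
  linarith

/-- A subcritical form of the Hardy–Littlewood–Sobolev inequality: since `H` is slightly more
integrable than the critical exponent requires, the near part of the kernel lies in the dual
Lebesgue space of Young's inequality, and the far part is bounded. -/
theorem integrable_mul_mul_div_norm_rpow (hd : 1 ≤ Module.finrank ℝ E) {H : E → ℝ}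
    (hm : Measurable H) (h0 : ∀ x, 0 ≤ H x) (h1 : Integrable H) {s β : ℝ} (hs : 1 < s)
    (hs2 : s < 2) (hHs : Integrable fun x => H x ^ s) (hβ : 0 < β)
    (hβs : β * s / (2 * (s - 1)) < Module.finrank ℝ E) :
    Integrable (fun w : E × E => H w.1 * H w.2 / ‖w.1 - w.2‖ ^ β) volume := by
  set γ := β * s / (2 * (s - 1))
  let κ : E → ℝ := (Metric.ball (0 : E) 1).indicator fun z => ‖z‖ ^ (-γ)
  have hκ : Integrable κ := by
    rw [integrable_indicator_iff Metric.isOpen_ball.measurableSet]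
    refine integrableOn_ball_of_norm_le_rpow (C := 1) (α := γ) hd hβs ?_ ?_
    · refine Eventually.of_forall fun x => ?_
      rw [Real.norm_of_nonneg (by positivity), one_mul]
    · exact (measurable_norm.pow_const _).aestronglyMeasurable
  have i1 : Integrable (fun w : E × E => H w.1 * H w.2) volume := h1.mul_prod h1
  have i2 : Integrable (fun w : E × E => H w.1 ^ s * H w.2 ^ s) volume := hHs.mul_prod hHs
  have i3 : Integrable (fun w : E × E => H w.2 ^ s * κ (w.1 - w.2)) volume :=
    hHs.convolution_integrand (ContinuousLinearMap.mul ℝ ℝ) hκ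
  have i4 : Integrable (fun w : E × E => H w.1 ^ s * κ (w.1 - w.2)) volume := by
    refine i3.swap.congr (Eventually.of_forall fun w => ?_)
    have : κ (w.2 - w.1) = κ (w.1 - w.2) := by
      simp only [κ, Set.indicator, mem_ball_zero_iff, norm_sub_rev]
    simp only [Function.comp, Prod.fst_swap, Prod.snd_swap, this]
  refine (((i1.add i2).add i4).add i3).mono' ?_ (Eventually.of_forall fun w => ?_)
  · refine Measurable.aestronglyMeasurable ?_
    exact ((hm.comp measurable_fst).mul (hm.comp measurable_snd)).div
      ((measurable_fst.sub measurable_snd).norm.pow_const _)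
  · simp only [Pi.add_apply]
    have ha := h0 w.1
    have hb := h0 w.2
    have has : 0 ≤ H w.1 ^ s := Real.rpow_nonneg ha s
    have hbs : 0 ≤ H w.2 ^ s := Real.rpow_nonneg hb s
    have hκ0 : 0 ≤ κ (w.1 - w.2) := Set.indicator_nonneg (fun z _ => by positivity) _
    rw [Real.norm_of_nonneg (by positivity)]
    by_cases hr : ‖w.1 - w.2‖ < 1
    · have hκe : κ (w.1 - w.2) = ‖w.1 - w.2‖ ^ (-γ) :=
        Set.indicator_of_mem (by simpa using hr) _
      rcases (norm_nonneg (w.1 - w.2)).eq_or_lt with h | h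
      · rw [← h, Real.zero_rpow hβ.ne', div_zero]
        positivity
      · rw [hκe, div_eq_mul_inv, ← Real.rpow_neg h.le]
        have := mul_rpow_neg_le_add (β := β) ha hb h hs hs2
        have : 0 ≤ H w.1 * H w.2 := by positivity
        linarith
    · have : H w.1 * H w.2 / ‖w.1 - w.2‖ ^ β ≤ H w.1 * H w.2 :=
        div_le_self (by positivity) (Real.one_le_rpow (not_lt.1 hr) hβ.le)
      have : 0 ≤ H w.1 ^ s * H w.2 ^ s + H w.1 ^ s * κ (w.1 - w.2) +
        H w.2 ^ s * κ (w.1 - w.2) := by positivity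
      linarith

end RieszPotential

section Growth

variable {N : ℕ} {α p q : ℝ}

theorem CondN.alpha_pos (h : CondN N α p q) : 0 < α := by
  have h1 := h.lower
  have h2 : (2 : ℝ) ≤ N := by exact_mod_cast h.two_le
  nlinarith [h.p_gt]

/-- For `u ∈ H^{1/2}`, products of functions with growth `|u|² + |u|^p` have finite Riesz energy. -/
theorem integrable_growth_mul_growth (h : CondN N α p q) {u : L2 N} (hu : u ∈ H12 N) :
    Integrable (fun w : Space N × Space N => (u w.1 ^ 2 + |u w.1| ^ p) * (u w.2 ^ 2 + |u w.2| ^ p)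
      / ‖w.1 - w.2‖ ^ ((N : ℝ) - α)) volume := by
  have hα := h.alpha_pos
  have hN2 : (2 : ℝ) ≤ N := by exact_mod_cast h.two_le
  have hN1 : 0 < (N : ℝ) - 1 := by linarith
  have hp := h.p_gt
  have hup := h.upper
  have hlow := h.lower
  have hNp : 0 < ((N : ℝ) - 1) * p := by positivity
  -- the lower bound on `s` makes the power of the kernel locally integrable, the upper bound keeps
  -- `p * s` below the critical Sobolev exponent; they are compatible as `(N - 1) p - N < α`
  obtain ⟨s, hs1, hs2⟩ : ∃ s, 2 * N / (N + α) < s ∧ s < min 2 (2 * N / ((N - 1) * p)) := by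
    apply exists_between
    rw [lt_min_iff]
    constructor
    · rw [div_lt_iff₀ (by linarith)]; linarith
    · exact div_lt_div_of_pos_left (by linarith) hNp (by linarith)
  have hs : 1 < s := by
    refine lt_trans ?_ hs1
    rw [lt_div_iff₀ (by linarith)]; linarith
  obtain ⟨hs2, hsp⟩ := lt_min_iff.1 hs2
  have hps : p * s < 2 * N / ((N : ℝ) - 1) := by
    rw [lt_div_iff₀ hNp] at hsp
    rw [lt_div_iff₀ hN1]
    linarith
  have hum : Measurable u := (Lp.stronglyMeasurable u).measurable
  have hi : ∀ r, 2 < r → r ≤ p * s → Integrable (fun x => |u x| ^ r) volume := fun r h1 h2 =>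
    integrable_abs_rpow h.two_le hu h1 (h2.trans_lt hps)
  have hm : Measurable fun x => u x ^ 2 + |u x| ^ p :=
    (hum.pow_const 2).add (hum.abs.pow_const p)
  have hH1 : Integrable (fun x => u x ^ 2 + |u x| ^ p) volume :=
    (integrable_sq u).add (hi p hp (by nlinarith))
  refine integrable_mul_mul_div_norm_rpow (s := s) (by simpa using (by linarith [h.two_le] : 1 ≤ N))
    hm (fun x => by positivity) hH1 hs hs2 ?_ (by linarith) ?_
  · have i1 := hi (2 * s) (by linarith) (by nlinarith)
    have i2 := hi (p * s) (by nlinarith) le_rfl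
    refine ((i1.add i2).const_mul (2 ^ (s - 1))).mono' (hm.pow_const s).aestronglyMeasurable
      (Eventually.of_forall fun x => ?_)
    rw [Real.norm_of_nonneg (by positivity), Pi.add_apply, Real.rpow_mul (abs_nonneg _),
      Real.rpow_mul (abs_nonneg _), Real.rpow_two, sq_abs]
    have hp0 : 0 ≤ |u x| ^ p := by positivity
    exact_mod_cast NNReal.rpow_add_le_mul_rpow_add_rpow ⟨_, sq_nonneg (u x)⟩ ⟨_, hp0⟩ hs.le
  · rw [finrank_euclideanSpace_fin, div_lt_iff₀ (by linarith)]
    rw [div_lt_iff₀ (by linarith)] at hs1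
    nlinarith

end Growth

/-! ### Monotone integrands along rays -/

section Fibre

open Set

variable {γ γ₁ γ₂ : ℝ → ℝ} {κ : ℝ}

/-- The integrand `s ↦ f(x, s u) u` along the ray through `u`, with the properties that the
positivity of `F` and the monotonicity of `f(x, t) / |t|^κ` give it. -/
structure IsFibre (κ : ℝ) (γ : ℝ → ℝ) : Prop where
  continuous : Continuous γ
  mono : MonotoneOn (fun s => γ s / s ^ κ) (Ioi 0)
  integral_nonneg : ∀ t, 0 < t → 0 ≤ ∫ s in (0 : ℝ)..t, γ s

/-- A negative value at `t` would make the integrand negative on all of `(0, t]`, by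
monotonicity. -/
theorem IsFibre.nonneg (h : IsFibre κ γ) {t : ℝ} (ht : 0 < t) : 0 ≤ γ t := by
  by_contra! hneg
  have hlt : ∀ s ∈ Ioc 0 t, γ s < 0 := by
    intro s hs
    have h1 : γ s / s ^ κ ≤ γ t / t ^ κ := h.mono hs.1 ht hs.2
    have h2 : γ t / t ^ κ < 0 := div_neg_of_neg_of_pos hneg (Real.rpow_pos_of_pos ht _)
    have h3 := h1.trans_lt h2
    have hp : 0 < s ^ κ := Real.rpow_pos_of_pos hs.1 _
    by_contra! h4
    exact absurd h3 (not_lt.2 (div_nonneg h4 hp.le))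
  have h5 : 0 < ∫ s in (0 : ℝ)..t, -γ s := by
    apply intervalIntegral.intervalIntegral_pos_of_pos_on
      ((h.continuous.neg).intervalIntegrable _ _) _ ht
    intro s hs
    exact neg_pos.2 (hlt s ⟨hs.1, hs.2.le⟩)
  rw [intervalIntegral.integral_neg] at h5
  linarith [h.integral_nonneg t ht]

theorem IsFibre.le_of_le (h : IsFibre κ γ) {a b : ℝ} (ha : 0 < a) (hab : a ≤ b) :
    γ a ≤ (a / b) ^ κ * γ b := by
  have hb := ha.trans_le hab
  have h1 : γ a / a ^ κ ≤ γ b / b ^ κ := h.mono ha hb hab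
  rw [div_le_iff₀ (Real.rpow_pos_of_pos ha _)] at h1
  rw [Real.div_rpow ha.le hb.le]
  exact h1.trans (le_of_eq (by ring))

theorem IsFibre.integral_le_of_le (h : IsFibre κ γ) {a b : ℝ} (ha : 0 < a) (hab : a ≤ b) :
    ∫ s in (0 : ℝ)..a, γ s ≤ (a / b) ^ (κ + 1) * ∫ s in (0 : ℝ)..b, γ s := by
  have hb := ha.trans_le hab
  have hc : 0 < a / b := by positivity
  have h1 : ∫ s in (0 : ℝ)..a, γ s = (a / b) * ∫ s in (0 : ℝ)..b, γ ((a / b) * s) := by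
    rw [intervalIntegral.mul_integral_comp_mul_left, mul_zero, div_mul_cancel₀ _ hb.ne']
  have h2 : ∫ s in (0 : ℝ)..b, γ ((a / b) * s) ≤ ∫ s in (0 : ℝ)..b, (a / b) ^ κ * γ s := by
    apply intervalIntegral.integral_mono_on_of_le_Ioo hb.le
    · exact (h.continuous.comp (continuous_const_mul _)).intervalIntegrable _ _
    · exact (h.continuous.const_mul _).intervalIntegrable _ _
    · intro s hs
      have hle : a / b * s ≤ s := mul_le_of_le_one_left hs.1.le ((div_le_one hb).2 hab)
      have := h.le_of_le (mul_pos hc hs.1) hle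
      rwa [mul_div_cancel_right₀ _ hs.1.ne'] at this
  rw [h1, Real.rpow_add hc, Real.rpow_one]
  rw [intervalIntegral.integral_const_mul] at h2
  calc _ ≤ a / b * ((a / b) ^ κ * ∫ s in (0 : ℝ)..b, γ s) := by gcongr
    _ = _ := by ring

/-- The Ambrosetti–Rabinowitz type inequality `(κ + 1) F ≤ f t`. -/
theorem IsFibre.mul_integral_le (h : IsFibre κ γ) (hκ : 0 < κ) {t : ℝ} (ht : 0 < t) :
    (κ + 1) * ∫ s in (0 : ℝ)..t, γ s ≤ γ t * t := by
  have h2 : ∫ s in (0 : ℝ)..t, γ s ≤ ∫ s in (0 : ℝ)..t, s ^ κ * (γ t / t ^ κ) := by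
    apply intervalIntegral.integral_mono_on_of_le_Ioo ht.le
    · exact h.continuous.intervalIntegrable _ _
    · exact (intervalIntegral.intervalIntegrable_rpow' (by linarith)).mul_const _
    · intro s hs
      have := h.le_of_le hs.1 hs.2.le
      rw [Real.div_rpow hs.1.le ht.le] at this
      exact this.trans (le_of_eq (by ring))
  rw [intervalIntegral.integral_mul_const, integral_rpow (Or.inl (by linarith)),
    Real.zero_rpow (by linarith), sub_zero] at h2
  have htk : 0 < t ^ κ := Real.rpow_pos_of_pos ht _
  calc _ ≤ (κ + 1) * (t ^ (κ + 1) / (κ + 1) * (γ t / t ^ κ)) := by gcongr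
    _ = _ := by
      rw [Real.rpow_add ht, Real.rpow_one]
      field_simp

theorem IsFibre.hasDerivAt (h : IsFibre κ γ) (t : ℝ) :
    HasDerivAt (fun t => ∫ s in (0 : ℝ)..t, γ s) (γ t) t :=
  intervalIntegral.integral_hasDerivAt_right (h.continuous.intervalIntegrable _ _)
    h.continuous.stronglyMeasurable.stronglyMeasurableAtFilter h.continuous.continuousAt

/-- Comparison of a product of two primitives with its homogeneous expansion at `t = 1`: the
derivative divided by `t^{2κ+1}` is non-decreasing. -/
theorem IsFibre.mul_sub_mul_ge (h₁ : IsFibre κ γ₁) (h₂ : IsFibre κ γ₂) (hκ : 0 < κ)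
    {t : ℝ} (ht : 0 < t) :
    (t ^ (2 * κ + 2) - 1) / (2 * κ + 2) *
        (γ₁ 1 * (∫ s in (0 : ℝ)..1, γ₂ s) + (∫ s in (0 : ℝ)..1, γ₁ s) * γ₂ 1) ≤
      (∫ s in (0 : ℝ)..t, γ₁ s) * (∫ s in (0 : ℝ)..t, γ₂ s) -
        (∫ s in (0 : ℝ)..1, γ₁ s) * (∫ s in (0 : ℝ)..1, γ₂ s) := by
  let Φ₁ : ℝ → ℝ := fun t => ∫ s in (0 : ℝ)..t, γ₁ s
  let Φ₂ : ℝ → ℝ := fun t => ∫ s in (0 : ℝ)..t, γ₂ s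
  set D := γ₁ 1 * Φ₂ 1 + Φ₁ 1 * γ₂ 1
  let ψ' : ℝ → ℝ := fun t => γ₁ t * Φ₂ t + Φ₁ t * γ₂ t
  let ρ : ℝ → ℝ := fun t => Φ₁ t * Φ₂ t - t ^ (2 * κ + 2) / (2 * κ + 2) * D
  have hd : ∀ s, 0 < s → HasDerivAt ρ (ψ' s - s ^ (2 * κ + 1) * D) s := by
    intro s hs
    have e : ψ' s - s ^ (2 * κ + 1) * D =
        (γ₁ s * Φ₂ s + Φ₁ s * γ₂ s) - (2 * κ + 2) * s ^ (2 * κ + 2 - 1) / (2 * κ + 2) * D := by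
      rw [mul_div_cancel_left₀ _ (by linarith), show 2 * κ + 2 - 1 = 2 * κ + 1 by ring]
    rw [e]
    exact ((h₁.hasDerivAt s).mul (h₂.hasDerivAt s)).sub
      (((Real.hasDerivAt_rpow_const (Or.inl hs.ne')).div_const _).mul_const _)
  -- the monotonicity of `ψ' / t^{2κ+1}`
  have hmono : ∀ a b, 0 < a → a ≤ b → ψ' a ≤ (a / b) ^ (2 * κ + 1) * ψ' b := by
    intro a b ha hab
    have hb := ha.trans_le hab
    have hc : 0 < a / b := by positivity
    have e : (a / b) ^ (2 * κ + 1) = (a / b) ^ κ * (a / b) ^ (κ + 1) := by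
      rw [← Real.rpow_add hc]; ring_nf
    have i1 : γ₁ a * Φ₂ a ≤ ((a / b) ^ κ * γ₁ b) * ((a / b) ^ (κ + 1) * Φ₂ b) :=
      mul_le_mul (h₁.le_of_le ha hab) (h₂.integral_le_of_le ha hab) (h₂.integral_nonneg a ha)
        (mul_nonneg (Real.rpow_nonneg hc.le _) (h₁.nonneg hb))
    have i2 : Φ₁ a * γ₂ a ≤ ((a / b) ^ (κ + 1) * Φ₁ b) * ((a / b) ^ κ * γ₂ b) :=
      mul_le_mul (h₁.integral_le_of_le ha hab) (h₂.le_of_le ha hab) (h₂.nonneg ha)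
        (mul_nonneg (Real.rpow_nonneg hc.le _) (h₁.integral_nonneg b hb))
    rw [e]
    simp only [ψ']
    linarith
  have hmin : ρ 1 ≤ ρ t := by
    rcases le_total 1 t with h1t | ht1
    · have hm : MonotoneOn ρ (Icc 1 t) := by
        apply monotoneOn_of_hasDerivWithinAt_nonneg (convex_Icc 1 t)
          (f' := fun s => ψ' s - s ^ (2 * κ + 1) * D)
        · intro s hs
          exact (hd s (by linarith [hs.1])).continuousAt.continuousWithinAt
        · intro s hs
          rw [interior_Icc] at hs
          exact (hd s (by linarith [hs.1])).hasDerivWithinAt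
        · intro s hs
          rw [interior_Icc] at hs
          have hs0 : 0 < s := by linarith [hs.1]
          have := hmono 1 s one_pos hs.1.le
          rw [Real.div_rpow zero_le_one hs0.le, Real.one_rpow, one_div_mul_eq_div,
            le_div_iff₀ (Real.rpow_pos_of_pos hs0 _)] at this
          have hD : ψ' 1 = D := rfl
          rw [hD] at this
          linarith
      exact hm ⟨le_rfl, h1t⟩ ⟨h1t, le_rfl⟩ h1t
    · have hm : AntitoneOn ρ (Icc t 1) := by
        apply antitoneOn_of_hasDerivWithinAt_nonpos (convex_Icc t 1)
          (f' := fun s => ψ' s - s ^ (2 * κ + 1) * D)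
        · intro s hs
          exact (hd s (by linarith [hs.1])).continuousAt.continuousWithinAt
        · intro s hs
          rw [interior_Icc] at hs
          exact (hd s (by linarith [hs.1])).hasDerivWithinAt
        · intro s hs
          rw [interior_Icc] at hs
          have := hmono s 1 (by linarith [hs.1]) hs.2.le
          rw [div_one] at this
          have hD : ψ' 1 = D := rfl
          rw [hD] at this
          linarith
      exact hm ⟨le_rfl, ht1⟩ ⟨ht1, le_rfl⟩ ht1
  simp only [ρ, Real.one_rpow] at hmin
  have : (t ^ (2 * κ + 2) - 1) / (2 * κ + 2) * D =
    t ^ (2 * κ + 2) / (2 * κ + 2) * D - 1 / (2 * κ + 2) * D := by ring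
  change (t ^ (2 * κ + 2) - 1) / (2 * κ + 2) * D ≤ Φ₁ t * Φ₂ t - Φ₁ 1 * Φ₂ 1
  linarith

/-- For `u < 0` the ray `s ↦ s u` runs through the negative half-line in the reverse direction, and
the factor `u < 0` restores the monotonicity. -/
theorem isFibre_of_monotoneOn {g : ℝ → ℝ} (hg : Continuous g)
    (hneg : MonotoneOn (fun t => g t / |t| ^ κ) (Iio 0))
    (hpos : MonotoneOn (fun t => g t / |t| ^ κ) (Ioi 0))
    (hF : ∀ t, 0 ≤ ∫ s in (0 : ℝ)..t, g s) (u : ℝ) : IsFibre κ fun s => g (s * u) * u := by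
  refine ⟨by fun_prop, ?_, ?_⟩
  · have e : ∀ s, 0 < s → u ≠ 0 →
      g (s * u) * u / s ^ κ = u * |u| ^ κ * (g (s * u) / |s * u| ^ κ) := by
      intro s hs hu
      have h1 : 0 < |u| ^ κ := Real.rpow_pos_of_pos (abs_pos.2 hu) _
      have h2 : 0 < s ^ κ := Real.rpow_pos_of_pos hs _
      rw [abs_mul, abs_of_pos hs, Real.mul_rpow hs.le (abs_nonneg _)]
      field_simp
    intro a ha b hb hab
    rcases lt_trichotomy u 0 with hu | rfl | hu
    · simp only
      rw [e a ha hu.ne, e b hb hu.ne]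
      apply mul_le_mul_of_nonpos_left
      · exact hneg (mul_neg_of_pos_of_neg hb hu) (mul_neg_of_pos_of_neg ha hu)
          (mul_le_mul_of_nonpos_right hab hu.le)
      · exact mul_nonpos_of_nonpos_of_nonneg hu.le (by positivity)
    · simp
    · simp only
      rw [e a ha hu.ne', e b hb hu.ne']
      apply mul_le_mul_of_nonneg_left _ (by positivity)
      exact hpos (mul_pos ha hu) (mul_pos hb hu) (mul_le_mul_of_nonneg_right hab hu.le)
  · intro t _
    rw [intervalIntegral.integral_mul_const, mul_comm, intervalIntegral.mul_integral_comp_mul_right,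
      zero_mul]
    exact hF _

end Fibre

/-! ### Regular representatives of the nonlinearity -/

section Regular

variable {N : ℕ} {α p q : ℝ} {f : Space N → ℝ → ℝ}

/-- A jointly measurable nonlinearity whose continuity, growth, sign and monotonicity properties
hold at every point. Every `f` as in the theorem agrees with such a function for almost every `x`,
see `exists_isRegular`. -/
structure IsRegular (p q : ℝ) (f : Space N → ℝ → ℝ) : Prop where
  measurable : Measurable (Function.uncurry f)
  continuous : ∀ x, Continuous (f x)
  growth : ∃ C > 0, ∀ x t, |f x t| ≤ C * (|t| + |t| ^ (p - 1))
  periodic : ∀ z : Fin N → ℤ, ∀ᵐ x, ∀ t, f (x + latticePt z) t = f x t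
  superlinear : ∀ M : ℝ, ∃ R > 0, ∀ᵐ x, ∀ t, R ≤ |t| → M ≤ primitive f x t / |t| ^ (q / 2)
  nonneg : ∀ x t, 0 ≤ primitive f x t
  mono_neg : ∀ x, MonotoneOn (fun t => f x t / |t| ^ ((q - 2) / 2)) (Set.Iio 0)
  mono_pos : ∀ x, MonotoneOn (fun t => f x t / |t| ^ ((q - 2) / 2)) (Set.Ioi 0)

/-- By `f(x, u) = o(u)`, the lower power `|u|^{α/N}` in the growth bound may be replaced by
`|u|`. -/
theorem growth_of_condF (hN : CondN N α p q) (hF1 : CondF1 α p f) (hF2 : CondF2 f) :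
    ∃ C > 0, ∀ᵐ x, ∀ t, |f x t| ≤ C * (|t| + |t| ^ (p - 1)) := by
  obtain ⟨C, hC, hgrowth⟩ := hF1.growth
  obtain ⟨δ, hδ, hsmall⟩ := hF2 1 one_pos
  have hα := hN.alpha_pos
  have hp := hN.p_gt
  have hN0 : 0 < (N : ℝ) := hα.trans hN.upper
  have hαN : α / N < 1 := (div_lt_one hN0).2 hN.upper
  refine ⟨1 + C * (1 + δ ^ (α / N - (p - 1))), by positivity, ?_⟩
  filter_upwards [hgrowth, hsmall] with x h1 h2 t
  have ht0 : 0 ≤ |t| ^ (p - 1) := by positivity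
  have hδ0 : 0 < δ ^ (α / N - (p - 1)) := Real.rpow_pos_of_pos hδ _
  rcases lt_or_ge |t| δ with ht | ht
  · refine (h2 t ht).trans ?_
    have h3 : 0 ≤ C * (1 + δ ^ (α / N - (p - 1))) := by positivity
    calc 1 * |t| ≤ 1 * (|t| + |t| ^ (p - 1)) := by linarith
      _ ≤ _ := by gcongr; linarith
  · have htpos : 0 < |t| := hδ.trans_le ht
    have h3 : |t| ^ (α / N) ≤ δ ^ (α / N - (p - 1)) * |t| ^ (p - 1) := by
      have : |t| ^ (α / N) = |t| ^ (α / N - (p - 1)) * |t| ^ (p - 1) := by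
        rw [← Real.rpow_add htpos]; ring_nf
      rw [this]
      exact mul_le_mul_of_nonneg_right (Real.rpow_le_rpow_of_nonpos hδ ht (by linarith)) ht0
    refine (h1 t).trans ?_
    calc C * (|t| ^ (α / N) + |t| ^ (p - 1))
        ≤ C * (δ ^ (α / N - (p - 1)) * |t| ^ (p - 1) + |t| ^ (p - 1)) := by gcongr
      _ = C * (1 + δ ^ (α / N - (p - 1))) * |t| ^ (p - 1) := by ring
      _ ≤ (1 + C * (1 + δ ^ (α / N - (p - 1)))) * (|t| + |t| ^ (p - 1)) := by
        gcongr
        · linarith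
        · linarith

/-- After a modification on a null set of points `x`, a Carathéodory function is jointly
measurable. -/
theorem exists_isRegular (hN : CondN N α p q) (hF1 : CondF1 α p f) (hF2 : CondF2 f)
    (hF3 : CondF3 q f) (hF4 : CondF4 q f) :
    ∃ g : Space N → ℝ → ℝ, IsRegular p q g ∧ ∀ᵐ x, g x = f x := by
  obtain ⟨C, hC, hgrowth⟩ := growth_of_condF hN hF1 hF2
  have hrat : ∀ᵐ x, ∀ r : ℚ, f x r = (hF1.measurable r).mk _ x := by
    rw [ae_all_iff]
    exact fun r => (hF1.measurable r).ae_eq_mk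
  have hgood := hF1.continuous.and (hgrowth.and (hF3.nonneg.and (hF4.and hrat)))
  -- `f` is replaced by zero on a measurable null set `T` off which all properties hold, and off
  -- which the values at rational `t` agree with measurable representatives
  obtain ⟨T, hTsub, hTm, hTae⟩ := exists_measurable_superset_of_null hgood
  have hTc : ∀ x, x ∉ T → Continuous (f x) ∧ (∀ t, |f x t| ≤ C * (|t| + |t| ^ (p - 1))) ∧
      (∀ t, 0 ≤ primitive f x t) ∧
      (MonotoneOn (fun t => f x t / |t| ^ ((q - 2) / 2)) (Set.Iio 0) ∧
        MonotoneOn (fun t => f x t / |t| ^ ((q - 2) / 2)) (Set.Ioi 0)) ∧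
      ∀ r : ℚ, f x r = (hF1.measurable r).mk _ x := by
    intro x hx
    by_contra h
    exact hx (hTsub h)
  classical
  let g : Space N → ℝ → ℝ := fun x t => if x ∈ T then 0 else f x t
  have hgf : ∀ x, x ∉ T → g x = f x := fun x hx => by ext t; simp [g, hx]
  have hg0 : ∀ x, x ∈ T → g x = 0 := fun x hx => by ext t; simp [g, hx]
  have hae : ∀ᵐ x, g x = f x := by
    have : ∀ᵐ x, x ∉ T := measure_eq_zero_iff_ae_notMem.1 hTae
    filter_upwards [this] with x hx using hgf x hx
  have hcont : ∀ x, Continuous (g x) := by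
    intro x
    by_cases hx : x ∈ T
    · rw [hg0 x hx]; exact continuous_zero
    · rw [hgf x hx]; exact (hTc x hx).1
  have hmr : ∀ r : ℚ, Measurable fun x => g x r := by
    intro r
    have : (fun x => g x r) = Tᶜ.indicator ((hF1.measurable r).mk _) := by
      ext x
      by_cases hx : x ∈ T
      · simp [g, hx]
      · simp [g, hx, (hTc x hx).2.2.2.2 r]
    rw [this]
    exact (hF1.measurable r).measurable_mk.indicator hTm.compl
  have hmt : ∀ t : ℝ, Measurable fun x => g x t := by
    intro t
    obtain ⟨r, hr⟩ : ∃ r : ℕ → ℚ, Tendsto (fun n => (r n : ℝ)) atTop (𝓝 t) := by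
      obtain ⟨y, hy, hyt⟩ := mem_closure_iff_seq_limit.1
        ((Rat.isDenseEmbedding_coe_real.dense : DenseRange ((↑) : ℚ → ℝ)) t)
      choose r hr using hy
      exact ⟨r, by simpa only [hr] using hyt⟩
    refine measurable_of_tendsto_metrizable (fun n => hmr (r n)) ?_
    rw [tendsto_pi_nhds]
    exact fun x => ((hcont x).tendsto t).comp hr
  have hprim : ∀ x, x ∉ T → primitive g x = primitive f x := by
    intro x hx; ext t; simp only [primitive, hgf x hx]
  have haen : ∀ᵐ x, primitive g x = primitive f x := by
    filter_upwards [hae] with x hx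
    ext t; simp only [primitive, hx]
  refine ⟨g, ⟨?_, hcont, ⟨C, hC, ?_⟩, ?_, ?_, ?_, ?_, ?_⟩, hae⟩
  · exact (measurable_uncurry_of_continuous_of_measurable (u := fun t x => g x t) hcont hmt).comp
      measurable_swap
  · intro x t
    by_cases hx : x ∈ T
    · rw [hg0 x hx, Pi.zero_apply, abs_zero]; positivity
    · rw [hgf x hx]; exact (hTc x hx).2.1 t
  · intro z
    filter_upwards [hF1.periodic z, hae,
      (measurePreserving_add_right (volume : Measure (Space N))
        (latticePt z)).quasiMeasurePreserving.ae hae] with x h1 h2 h3 t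
    rw [h2, h3, h1]
  · intro M
    obtain ⟨R, hR, h⟩ := hF3.superlinear M
    refine ⟨R, hR, ?_⟩
    filter_upwards [h, haen] with x h1 h2
    rw [h2]; exact h1
  · intro x t
    by_cases hx : x ∈ T
    · simp [primitive, hg0 x hx]
    · rw [hprim x hx]; exact (hTc x hx).2.2.1 t
  · intro x
    by_cases hx : x ∈ T
    · rw [hg0 x hx]; intro a _ b _ _; simp
    · rw [hgf x hx]; exact (hTc x hx).2.2.2.1.1
  · intro x
    by_cases hx : x ∈ T
    · rw [hg0 x hx]; intro a _ b _ _; simp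
    · rw [hgf x hx]; exact (hTc x hx).2.2.2.1.2

theorem ae_prod_of_ae {P : Space N → Prop} (h : ∀ᵐ x, P x) :
    ∀ᵐ w : Space N × Space N, P w.1 ∧ P w.2 :=
  (Measure.quasiMeasurePreserving_fst.ae h).and (Measure.quasiMeasurePreserving_snd.ae h)

theorem primitive_congr {f g : Space N → ℝ → ℝ} {x : Space N} (h : g x = f x) (t : ℝ) :
    primitive g x t = primitive f x t := by
  simp only [primitive, h]

theorem energy_congr {f g : Space N → ℝ → ℝ} (h : ∀ᵐ x, g x = f x) (m μ α q : ℝ)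
    (V K : Space N → ℝ) : energy m μ α q V K g = energy m μ α q V K f := by
  ext u
  have : doubleInt α g u = doubleInt α f u := by
    apply integral_congr_ae
    filter_upwards [ae_prod_of_ae h] with w hw
    rw [primitive_congr hw.1, primitive_congr hw.2]
  rw [energy, energy, this]

theorem nehari_congr {f g : Space N → ℝ → ℝ} (h : ∀ᵐ x, g x = f x) (m μ α q : ℝ)
    (V K : Space N → ℝ) : nehari m μ α q V K g = nehari m μ α q V K f := by
  have : ∀ u : L2 N, energyDeriv m μ α q V K g u u = energyDeriv m μ α q V K f u u := by
    intro u
    have : (∫ w : Space N × Space N, primitive g w.1 (u w.1) * (g w.2 (u w.2) * u w.2) /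
        ‖w.1 - w.2‖ ^ ((N : ℝ) - α)) = ∫ w : Space N × Space N,
        primitive f w.1 (u w.1) * (f w.2 (u w.2) * u w.2) / ‖w.1 - w.2‖ ^ ((N : ℝ) - α) := by
      apply integral_congr_ae
      filter_upwards [ae_prod_of_ae h] with w hw
      rw [primitive_congr hw.1, hw.2]
    rw [energyDeriv, energyDeriv, this]
  simp only [nehari, this]

end Regular

/-! ### The nonlocal term along rays -/

section Nonlocal

variable {N : ℕ} {α p q : ℝ} {f : Space N → ℝ → ℝ}

theorem primitive_mul (f : Space N → ℝ → ℝ) (x : Space N) (t u : ℝ) :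
    primitive f x (t * u) = ∫ s in (0 : ℝ)..t, f x (s * u) * u := by
  have h := intervalIntegral.mul_integral_comp_mul_right (f := f x) (a := 0) (b := t) u
  rw [zero_mul] at h
  rw [primitive, intervalIntegral.integral_mul_const, ← h, mul_comm]

namespace IsRegular

theorem isFibre (hf : IsRegular p q f) (x : Space N) (u : ℝ) :
    IsFibre ((q - 2) / 2) fun s => f x (s * u) * u :=
  isFibre_of_monotoneOn (hf.continuous x) (hf.mono_neg x) (hf.mono_pos x) (hf.nonneg x) u

theorem mul_self_nonneg (hf : IsRegular p q f) (x : Space N) (u : ℝ) : 0 ≤ f x u * u := by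
  simpa using (hf.isFibre x u).nonneg one_pos

/-- The Ambrosetti–Rabinowitz condition with exponent `q/2`. -/
theorem mul_primitive_le (hf : IsRegular p q f) (hq : 2 < q) (x : Space N) (u : ℝ) :
    q / 2 * primitive f x u ≤ f x u * u := by
  have h := (hf.isFibre x u).mul_integral_le (by linarith) one_pos
  rw [← primitive_mul] at h
  simp only [one_mul, mul_one] at h
  convert h using 2
  ring

theorem primitive_mul_le (hf : IsRegular p q f) (x : Space N) {t : ℝ} (ht : 0 < t) (ht1 : t ≤ 1)
    (u : ℝ) : primitive f x (t * u) ≤ t ^ (q / 2) * primitive f x u := by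
  have h := (hf.isFibre x u).integral_le_of_le ht ht1
  rw [← primitive_mul, ← primitive_mul, div_one, one_mul] at h
  convert h using 3
  ring

theorem mul_self_mul_le (hf : IsRegular p q f) (x : Space N) {t : ℝ} (ht : 0 < t) (ht1 : t ≤ 1)
    (u : ℝ) : f x (t * u) * (t * u) ≤ t ^ (q / 2) * (f x u * u) := by
  have h := (hf.isFibre x u).le_of_le ht ht1
  simp only [div_one, one_mul] at h
  have e : t ^ (q / 2) = t ^ ((q - 2) / 2) * t := by
    rw [← Real.rpow_add_one ht.ne']; ring_nf
  rw [e]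
  calc _ = t * (f x (t * u) * u) := by ring
    _ ≤ t * (t ^ ((q - 2) / 2) * (f x u * u)) := by gcongr
    _ = _ := by ring

theorem mul_sub_mul_ge (hf : IsRegular p q f) (hq : 2 < q) (x y : Space N) {t : ℝ} (ht : 0 < t)
    (u v : ℝ) :
    (t ^ q - 1) / q * (f x u * u * primitive f y v + primitive f x u * (f y v * v)) ≤
      primitive f x (t * u) * primitive f y (t * v) - primitive f x u * primitive f y v := by
  have h := (hf.isFibre x u).mul_sub_mul_ge (hf.isFibre y v) (by linarith) ht
  simp only [← primitive_mul, one_mul] at h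
  rwa [show 2 * ((q - 2) / 2) + 2 = q by ring] at h

theorem continuous_primitive (hf : IsRegular p q f) (x : Space N) :
    Continuous (primitive f x) :=
  intervalIntegral.continuous_primitive (fun _ _ => (hf.continuous x).intervalIntegrable _ _) 0

theorem measurable_primitive (hf : IsRegular p q f) :
    Measurable (Function.uncurry (primitive f)) := by
  have hm : ∀ t, Measurable fun x => primitive f x t := by
    intro t
    simp only [primitive, intervalIntegral]
    exact (hf.measurable.stronglyMeasurable.integral_prod_right.sub
      hf.measurable.stronglyMeasurable.integral_prod_right).measurable
  exact (measurable_uncurry_of_continuous_of_measurable (u := fun t x => primitive f x t)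
    hf.continuous_primitive hm).comp measurable_swap

/-- Growth of `f(x, t) t` and `F(x, t)` along a bounded range of dilations. -/
theorem exists_growth (hf : IsRegular p q f) (hp : 2 < p) {T : ℝ} (hT : 0 ≤ T) :
    ∃ C, 0 ≤ C ∧ ∀ x t u, |t| ≤ T →
      |f x (t * u) * (t * u)| ≤ C * (u ^ 2 + |u| ^ p) ∧
      |primitive f x (t * u)| ≤ C * (u ^ 2 + |u| ^ p) := by
  obtain ⟨C, hC, h⟩ := hf.growth
  refine ⟨C * (T ^ 2 + T ^ p), by positivity, fun x t u ht => ?_⟩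
  have hpow : ∀ s : ℝ, (|s| + |s| ^ (p - 1)) * |s| = s ^ 2 + |s| ^ p := by
    intro s
    rw [add_mul, ← Real.rpow_add_one' (abs_nonneg s) (by linarith), sub_add_cancel, ← sq, sq_abs]
  have hb : C * ((t * u) ^ 2 + |t * u| ^ p) ≤ C * (T ^ 2 + T ^ p) * (u ^ 2 + |u| ^ p) := by
    rw [mul_assoc, abs_mul, Real.mul_rpow (abs_nonneg _) (abs_nonneg _), mul_pow]
    have h1 : t ^ 2 ≤ T ^ 2 := sq_le_sq' (by linarith [abs_le.1 ht]) (abs_le.1 ht).2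
    have h2 : |t| ^ p ≤ T ^ p := Real.rpow_le_rpow (abs_nonneg _) ht (by linarith)
    have h3 : 0 ≤ T ^ p := by positivity
    have h4 : 0 ≤ |u| ^ p := by positivity
    gcongr
    nlinarith [mul_le_mul_of_nonneg_right h1 (sq_nonneg u), mul_le_mul_of_nonneg_right h2 h4,
      mul_nonneg (sq_nonneg T) h4, mul_nonneg h3 (sq_nonneg u)]
  constructor
  · refine le_trans ?_ hb
    rw [abs_mul, ← hpow, ← mul_assoc]
    gcongr
    exact h x _
  · refine le_trans ?_ hb
    rw [← hpow, ← mul_assoc]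
    have := intervalIntegral.norm_integral_le_of_norm_le_const (a := 0) (b := t * u) (f := f x)
      (C := C * (|t * u| + |t * u| ^ (p - 1))) ?_
    · simpa [primitive] using this
    · intro s hs
      have hs' : |s| ≤ |t * u| := by
        rcases le_total 0 (t * u) with h0 | h0
        · rw [Set.uIoc_of_le h0] at hs
          rw [abs_of_pos hs.1, abs_of_nonneg h0]; exact hs.2
        · rw [Set.uIoc_of_ge h0] at hs
          rw [abs_of_nonpos hs.2, abs_of_nonpos h0]; linarith [hs.1]
      refine (h x s).trans ?_
      gcongr
      linarith

variable {u : L2 N}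

theorem measurable_comp_primitive (hf : IsRegular p q f) (t : ℝ) (u : L2 N) :
    Measurable fun x => primitive f x (t * u x) :=
  hf.measurable_primitive.comp (measurable_id.prodMk
    ((Lp.stronglyMeasurable u).measurable.const_mul t))

theorem measurable_comp (hf : IsRegular p q f) (t : ℝ) (u : L2 N) :
    Measurable fun x => f x (t * u x) * (t * u x) :=
  (hf.measurable.comp (measurable_id.prodMk
    ((Lp.stronglyMeasurable u).measurable.const_mul t))).mul
    ((Lp.stronglyMeasurable u).measurable.const_mul t)

theorem _root_.Choquard.measurable_mul_div {A B : Space N → ℝ} (hA : Measurable A)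
    (hB : Measurable B) (β : ℝ) :
    Measurable fun w : Space N × Space N => A w.1 * B w.2 / ‖w.1 - w.2‖ ^ β :=
  ((hA.comp measurable_fst).mul (hB.comp measurable_snd)).div
    ((measurable_fst.sub measurable_snd).norm.pow_const _)

theorem _root_.Choquard.integrable_mul_div_of_growth (hN : CondN N α p q) (hu : u ∈ H12 N)
    {A B : Space N → ℝ}
    (hA : Measurable A) (hB : Measurable B) {C : ℝ} (hC : 0 ≤ C)
    (hAC : ∀ x, |A x| ≤ C * (u x ^ 2 + |u x| ^ p)) (hBC : ∀ x, |B x| ≤ C * (u x ^ 2 + |u x| ^ p)) :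
    Integrable (fun w : Space N × Space N => A w.1 * B w.2 / ‖w.1 - w.2‖ ^ ((N : ℝ) - α))
      volume := by
  refine ((integrable_growth_mul_growth hN hu).const_mul (C ^ 2)).mono'
    (measurable_mul_div hA hB _).aestronglyMeasurable (Eventually.of_forall fun w => ?_)
  rw [norm_div, norm_mul, Real.norm_of_nonneg (by positivity : 0 ≤ ‖w.1 - w.2‖ ^ ((N : ℝ) - α)),
    Real.norm_eq_abs, Real.norm_eq_abs, ← mul_div_assoc]
  refine div_le_div_of_nonneg_right ?_ (by positivity)
  calc _ ≤ (C * (u w.1 ^ 2 + |u w.1| ^ p)) * (C * (u w.2 ^ 2 + |u w.2| ^ p)) := by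
        gcongr
        · exact hAC _
        · exact hBC _
    _ = _ := by ring

theorem integrable_primitive_mul_primitive (hf : IsRegular p q f) (hN : CondN N α p q)
    (hu : u ∈ H12 N) (t : ℝ) :
    Integrable (fun w : Space N × Space N => primitive f w.1 (t * u w.1) *
      primitive f w.2 (t * u w.2) / ‖w.1 - w.2‖ ^ ((N : ℝ) - α)) volume := by
  obtain ⟨C, hC, h⟩ := hf.exists_growth hN.p_gt (abs_nonneg t)
  exact integrable_mul_div_of_growth hN hu (hf.measurable_comp_primitive t u)
    (hf.measurable_comp_primitive t u) hC (fun x => (h x t (u x) le_rfl).2)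
    (fun x => (h x t (u x) le_rfl).2)

theorem integrable_primitive_mul (hf : IsRegular p q f) (hN : CondN N α p q)
    (hu : u ∈ H12 N) (t : ℝ) :
    Integrable (fun w : Space N × Space N => primitive f w.1 (t * u w.1) *
      (f w.2 (t * u w.2) * (t * u w.2)) / ‖w.1 - w.2‖ ^ ((N : ℝ) - α)) volume := by
  obtain ⟨C, hC, h⟩ := hf.exists_growth hN.p_gt (abs_nonneg t)
  exact integrable_mul_div_of_growth hN hu (hf.measurable_comp_primitive t u)
    (hf.measurable_comp t u) hC (fun x => (h x t (u x) le_rfl).2)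
    (fun x => (h x t (u x) le_rfl).1)

end IsRegular

/-- The nonlocal part of `𝓔'(tu)(tu)`. -/
def nonlocalDeriv (α : ℝ) (f : Space N → ℝ → ℝ) (u : L2 N) (t : ℝ) : ℝ :=
  ∫ w : Space N × Space N, primitive f w.1 (t * u w.1) *
    (f w.2 (t * u w.2) * (t * u w.2)) / ‖w.1 - w.2‖ ^ ((N : ℝ) - α)

theorem doubleInt_smul (α : ℝ) (f : Space N → ℝ → ℝ) (u : L2 N) (t : ℝ) :
    doubleInt α f (t • u) = ∫ w : Space N × Space N, primitive f w.1 (t * u w.1) *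
      primitive f w.2 (t * u w.2) / ‖w.1 - w.2‖ ^ ((N : ℝ) - α) := by
  apply integral_congr_ae
  filter_upwards [ae_prod_of_ae (Lp.coeFn_smul t u)] with w hw
  simp only [hw.1, hw.2, Pi.smul_apply, smul_eq_mul]

namespace IsRegular

variable {u : L2 N}

theorem continuousOn_nonlocalDeriv (hf : IsRegular p q f) (hN : CondN N α p q)
    (hu : u ∈ H12 N) (T : ℝ) : ContinuousOn (nonlocalDeriv α f u) (Set.Icc 0 T) := by
  rcases lt_or_ge T 0 with hT | hT
  · simp [Set.Icc_eq_empty (not_le.2 hT)]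
  obtain ⟨C, hC, h⟩ := hf.exists_growth hN.p_gt hT
  refine continuousOn_of_dominated (bound := fun w => C ^ 2 * ((u w.1 ^ 2 + |u w.1| ^ p) *
    (u w.2 ^ 2 + |u w.2| ^ p) / ‖w.1 - w.2‖ ^ ((N : ℝ) - α))) ?_ ?_ ?_ ?_
  · exact fun t _ => (hf.integrable_primitive_mul hN hu t).aestronglyMeasurable
  · refine fun t ht => Eventually.of_forall fun w => ?_
    have ht' : |t| ≤ T := by rw [abs_of_nonneg ht.1]; exact ht.2
    rw [norm_div, norm_mul, Real.norm_of_nonneg (by positivity : 0 ≤ ‖w.1 - w.2‖ ^ ((N : ℝ) - α)),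
      Real.norm_eq_abs, Real.norm_eq_abs, ← mul_div_assoc]
    refine div_le_div_of_nonneg_right ?_ (by positivity)
    calc _ ≤ (C * (u w.1 ^ 2 + |u w.1| ^ p)) * (C * (u w.2 ^ 2 + |u w.2| ^ p)) := by
          gcongr
          · exact (h _ _ _ ht').2
          · exact (h _ _ _ ht').1
      _ = _ := by ring
  · exact (integrable_growth_mul_growth hN hu).const_mul _
  · refine Eventually.of_forall fun w => Continuous.continuousOn ?_
    have h1 := (hf.continuous_primitive w.1).comp (continuous_mul_const (u w.1))
    have h2 := (hf.continuous w.2).comp (continuous_mul_const (u w.2))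
    exact (h1.mul (h2.mul (continuous_mul_const (u w.2)))).div_const _

theorem nonlocalDeriv_le (hf : IsRegular p q f) (hN : CondN N α p q)
    (hu : u ∈ H12 N) {t : ℝ} (ht : 0 < t) (ht1 : t ≤ 1) :
    nonlocalDeriv α f u t ≤ t ^ q * nonlocalDeriv α f u 1 := by
  rw [nonlocalDeriv, nonlocalDeriv, ← integral_const_mul]
  refine integral_mono (hf.integrable_primitive_mul hN hu t)
    ((hf.integrable_primitive_mul hN hu 1).const_mul _) fun w => ?_
  simp only
  rw [← mul_div_assoc]
  refine div_le_div_of_nonneg_right ?_ (by positivity)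
  have e : t ^ q = t ^ (q / 2) * t ^ (q / 2) := by rw [← Real.rpow_add ht]; ring_nf
  rw [e, one_mul, one_mul]
  calc _ ≤ (t ^ (q / 2) * primitive f w.1 (u w.1)) * (t ^ (q / 2) * (f w.2 (u w.2) * u w.2)) :=
        mul_le_mul (hf.primitive_mul_le _ ht ht1 _) (hf.mul_self_mul_le _ ht ht1 _)
          (hf.mul_self_nonneg _ _) (mul_nonneg (by positivity) (hf.nonneg _ _))
    _ = _ := by ring

/-- The integrated form of `IsFibre.mul_sub_mul_ge`; by symmetry of the kernel both mixed terms
integrate to `nonlocalDeriv`. -/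
theorem doubleInt_sub_ge (hf : IsRegular p q f) (hN : CondN N α p q)
    (hu : u ∈ H12 N) {t : ℝ} (ht : 0 < t) :
    (t ^ q - 1) / q * (2 * nonlocalDeriv α f u 1) ≤
      doubleInt α f (t • u) - doubleInt α f ((1 : ℝ) • u) := by
  have i1 := hf.integrable_primitive_mul hN hu 1
  have i2 : Integrable (fun w : Space N × Space N => primitive f w.2 (1 * u w.2) *
      (f w.1 (1 * u w.1) * (1 * u w.1)) / ‖w.2 - w.1‖ ^ ((N : ℝ) - α)) volume := i1.swap
  have e : 2 * nonlocalDeriv α f u 1 = ∫ w : Space N × Space N,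
      ((primitive f w.2 (1 * u w.2) * (f w.1 (1 * u w.1) * (1 * u w.1)) /
        ‖w.2 - w.1‖ ^ ((N : ℝ) - α)) + primitive f w.1 (1 * u w.1) *
        (f w.2 (1 * u w.2) * (1 * u w.2)) / ‖w.1 - w.2‖ ^ ((N : ℝ) - α)) := by
    rw [integral_add i2 i1, two_mul]
    congr 1
    rw [nonlocalDeriv, Measure.volume_eq_prod, ← integral_prod_swap]
    rfl
  rw [e, doubleInt_smul, doubleInt_smul, ← integral_const_mul, ← integral_sub
    (hf.integrable_primitive_mul_primitive hN hu t) (hf.integrable_primitive_mul_primitive hN hu 1)]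
  refine integral_mono ((i2.add i1).const_mul _)
    ((hf.integrable_primitive_mul_primitive hN hu t).sub
      (hf.integrable_primitive_mul_primitive hN hu 1)) fun w => ?_
  simp only
  rw [norm_sub_rev w.2 w.1, ← add_div, ← mul_div_assoc, ← sub_div]
  refine div_le_div_of_nonneg_right ?_ (by positivity)
  have := hf.mul_sub_mul_ge hN.q_gt w.1 w.2 ht (u w.1) (u w.2)
  simp only [one_mul]
  linarith

theorem _root_.Choquard.ae_norm_sub_pos (hN : 2 ≤ N) :
    ∀ᵐ w : Space N × Space N, 0 < ‖w.1 - w.2‖ := by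
  have : Nontrivial (Space N) :=
    Module.nontrivial_of_finrank_pos (R := ℝ) (by rw [finrank_euclideanSpace_fin]; omega)
  have h : ∀ᵐ x : Space N, x ≠ 0 := by simp [ae_iff]
  have := (quasiMeasurePreserving_sub_of_right_invariant (volume : Measure (Space N))
    (volume : Measure (Space N))).ae h
  filter_upwards [this] with w hw using norm_pos_iff.2 hw

/-- The nonlocal term grows faster than `t^q` along rays. -/
theorem exists_nonlocalDeriv_gt (hf : IsRegular p q f) (hN : CondN N α p q)
    (hu : u ∈ H12 N) (hu0 : u ≠ 0) (A : ℝ) :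
    ∃ T, 1 ≤ T ∧ A * T ^ q < nonlocalDeriv α f u T := by
  have hum : Measurable u := (Lp.stronglyMeasurable u).measurable
  obtain ⟨δ, hδ, hS⟩ : ∃ δ : ℝ, 0 < δ ∧ volume {x | δ ≤ |u x|} ≠ 0 := by
    by_contra! hcon
    apply hu0
    rw [Lp.eq_zero_iff_ae_eq_zero]
    have : ∀ᵐ x, ∀ n : ℕ, ¬ (1 / ((n : ℝ) + 1) ≤ |u x|) := by
      rw [ae_all_iff]
      intro n
      exact measure_eq_zero_iff_ae_notMem.1 (hcon _ (by positivity))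
    filter_upwards [this] with x hx
    by_contra h
    obtain ⟨n, hn⟩ := exists_nat_one_div_lt (abs_pos.2 h)
    exact hx n hn.le
  set S := {x | δ ≤ |u x|}
  have hSm : MeasurableSet S := measurableSet_le measurable_const hum.abs
  let χ : Space N → ℝ := S.indicator fun _ => 1
  have hχm : Measurable χ := measurable_const.indicator hSm
  have hχ0 : ∀ x, 0 ≤ χ x := fun x => Set.indicator_nonneg (fun _ _ => zero_le_one) x
  let I : Space N × Space N → ℝ := fun w => χ w.1 * χ w.2 / ‖w.1 - w.2‖ ^ ((N : ℝ) - α)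
  have hχC : ∀ x, |χ x| ≤ (δ ^ 2)⁻¹ * (u x ^ 2 + |u x| ^ p) := by
    intro x
    rw [abs_of_nonneg (hχ0 x)]
    by_cases hx : x ∈ S
    · have hx' : δ ≤ |u x| := hx
      have h1 : δ ^ 2 ≤ u x ^ 2 := by rw [← sq_abs (u x)]; gcongr
      have h2 : 0 ≤ |u x| ^ p := by positivity
      simp only [χ, Set.indicator_of_mem hx]
      rw [inv_mul_eq_div, le_div_iff₀ (by positivity)]
      linarith
    · simp only [χ, Set.indicator_of_notMem hx]; positivity
  have hIint : Integrable I volume :=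
    integrable_mul_div_of_growth hN hu hχm hχm (by positivity) hχC hχC
  have hI0 : ∀ w, 0 ≤ I w := fun w =>
    div_nonneg (mul_nonneg (hχ0 _) (hχ0 _)) (by positivity)
  have hc : 0 < ∫ w, I w := by
    rw [integral_pos_iff_support_of_nonneg hI0 hIint]
    have hprod : 0 < volume (S ×ˢ S) := by
      rw [Measure.volume_eq_prod, Measure.prod_prod]
      exact ENNReal.mul_pos hS hS
    refine hprod.trans_le (measure_mono_ae ?_)
    filter_upwards [ae_norm_sub_pos hN.two_le] with w hw (hwS : w ∈ S ×ˢ S)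
    have : I w = 1 / ‖w.1 - w.2‖ ^ ((N : ℝ) - α) := by
      simp only [I, χ, Set.indicator_of_mem hwS.1, Set.indicator_of_mem hwS.2, mul_one]
    change I w ≠ 0
    rw [this]
    positivity
  set c := ∫ w, I w
  have hq := hN.q_gt
  -- `F` is at least `L |t|^{q/2}` for large `t`, with `L` beating `A`
  have hk : 0 < q / 2 * δ ^ q * c := by have := Real.rpow_pos_of_pos hδ q; positivity
  set L := 1 + |A| / (q / 2 * δ ^ q * c)
  have hL1 : 1 ≤ L := by have : 0 ≤ |A| / (q / 2 * δ ^ q * c) := by positivity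
                         linarith
  obtain ⟨R, hR, hsup⟩ := hf.superlinear L
  set T := max 1 (R / δ)
  have hT1 : 1 ≤ T := le_max_left _ _
  have hT0 : 0 < T := by linarith
  have hTR : R ≤ T * δ := by
    rw [← div_le_iff₀ hδ]; exact le_max_right _ _
  refine ⟨T, hT1, ?_⟩
  have hlow : ∀ᵐ x, L * (T * δ) ^ (q / 2) * χ x ≤ primitive f x (T * u x) := by
    filter_upwards [hsup] with x hx
    by_cases hxS : x ∈ S
    · have hxS' : δ ≤ |u x| := hxS
      have h1 : T * δ ≤ |T * u x| := by
        rw [abs_mul, abs_of_pos hT0]; gcongr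
      have h2 := hx (T * u x) (hTR.trans h1)
      have hpos : 0 < |T * u x| := lt_of_lt_of_le (by positivity) h1
      rw [le_div_iff₀ (Real.rpow_pos_of_pos hpos _)] at h2
      simp only [χ, Set.indicator_of_mem hxS, mul_one]
      refine le_trans ?_ h2
      gcongr
    · simp only [χ, Set.indicator_of_notMem hxS, mul_zero]
      exact hf.nonneg _ _
  have hmono : ∫ w, q / 2 * (L * (T * δ) ^ (q / 2)) ^ 2 * I w ≤ nonlocalDeriv α f u T := by
    refine integral_mono_ae (hIint.const_mul _) (hf.integrable_primitive_mul hN hu T) ?_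
    filter_upwards [ae_prod_of_ae hlow] with w hw
    simp only [I]
    rw [← mul_div_assoc]
    refine div_le_div_of_nonneg_right ?_ (by positivity)
    have hl0 : 0 ≤ L * (T * δ) ^ (q / 2) := by positivity
    have h1 := hf.mul_primitive_le hq w.2 (T * u w.2)
    have h2 : q / 2 * (L * (T * δ) ^ (q / 2) * χ w.2) ≤ f w.2 (T * u w.2) * (T * u w.2) :=
      le_trans (mul_le_mul_of_nonneg_left hw.2 (by linarith)) h1
    calc _ = (L * (T * δ) ^ (q / 2) * χ w.1) * (q / 2 * (L * (T * δ) ^ (q / 2) * χ w.2)) := by ring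
      _ ≤ _ := mul_le_mul hw.1 h2
        (mul_nonneg (by linarith) (mul_nonneg hl0 (hχ0 _))) (hf.nonneg _ _)
  rw [integral_const_mul] at hmono
  refine lt_of_lt_of_le ?_ hmono
  have e : ((T * δ) ^ (q / 2)) ^ 2 = T ^ q * δ ^ q := by
    rw [← Real.rpow_natCast, ← Real.rpow_mul (by positivity), ← Real.mul_rpow hT0.le hδ.le]
    congr 1; push_cast; ring
  have hTq : 0 < T ^ q := Real.rpow_pos_of_pos hT0 _
  have hL2 : L ≤ L ^ 2 := by nlinarith
  have hAL : A < L * (q / 2 * δ ^ q * c) := by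
    have : L * (q / 2 * δ ^ q * c) = q / 2 * δ ^ q * c + |A| := by
      simp only [L]; field_simp
    rw [this]
    linarith [le_abs_self A]
  calc A * T ^ q < L * (q / 2 * δ ^ q * c) * T ^ q := by gcongr
    _ ≤ L ^ 2 * (q / 2 * δ ^ q * c) * T ^ q := by gcongr
    _ = _ := by rw [mul_pow, e]; ring

end IsRegular

end Nonlocal

/-! ### The energy along rays and under translations -/

theorem exists_ae_abs_le {N : ℕ} {W : Space N → ℝ} (hW : MemLp W ∞ volume) :
    ∃ C : ℝ, ∀ᵐ x, |W x| ≤ C := by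
  have h := hW.eLpNorm_lt_top
  rw [eLpNorm_exponent_top] at h
  refine ⟨(eLpNormEssSup W volume).toReal, ?_⟩
  filter_upwards [enorm_ae_le_eLpNormEssSup W volume] with x hx
  rw [← Real.norm_eq_abs, ← toReal_enorm]
  exact ENNReal.toReal_mono h.ne hx

section Nehari

variable {N : ℕ} {m μ α p q : ℝ} {V Vp Vl K : Space N → ℝ} {f : Space N → ℝ → ℝ} {u : L2 N}

/-- The quadratic form of the linear part of the equation. -/
def quadForm (m μ : ℝ) (V : Space N → ℝ) (u : L2 N) : ℝ :=
  (∫ ξ, symbol m ξ * ‖hat u ξ‖ ^ 2) + (∫ x, (V x - m) * u x ^ 2) - μ * (∫ x, u x ^ 2 / ‖x‖)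

/-- The local power term `∫ K |u|^q`. -/
def powerInt (q : ℝ) (K : Space N → ℝ) (u : L2 N) : ℝ := ∫ x, K x * |u x| ^ q

/-- The part `∫ (V_l - μ / |x|) u²` of the quadratic form that is not invariant under lattice
translations. -/
def localizedForm (μ : ℝ) (Vl : Space N → ℝ) (u : L2 N) : ℝ :=
  (∫ x, Vl x * u x ^ 2) - μ * (∫ x, u x ^ 2 / ‖x‖)

theorem integral_symbol_smul (m t : ℝ) (u : L2 N) :
    ∫ ξ, symbol m ξ * ‖hat (t • u) ξ‖ ^ 2 = t ^ 2 * ∫ ξ, symbol m ξ * ‖hat u ξ‖ ^ 2 := by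
  rw [← integral_const_mul]
  apply integral_congr_ae
  filter_upwards [hat_smul t u] with ξ h
  rw [h, norm_mul, Complex.norm_real, mul_pow, Real.norm_eq_abs, sq_abs]; ring

theorem integral_mul_sq_smul (W : Space N → ℝ) (t : ℝ) (u : L2 N) :
    ∫ x, W x * (t • u : L2 N) x ^ 2 = t ^ 2 * ∫ x, W x * u x ^ 2 := by
  rw [← integral_const_mul]
  apply integral_congr_ae
  filter_upwards [Lp.coeFn_smul t u] with x h
  rw [h, Pi.smul_apply, smul_eq_mul]; ring

theorem integral_sq_div_norm_smul (t : ℝ) (u : L2 N) :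
    ∫ x, (t • u : L2 N) x ^ 2 / ‖x‖ = t ^ 2 * ∫ x, u x ^ 2 / ‖x‖ := by
  simpa only [div_eq_inv_mul] using integral_mul_sq_smul (fun x : Space N => ‖x‖⁻¹) t u

theorem powerInt_smul (q : ℝ) (K : Space N → ℝ) {t : ℝ} (ht : 0 < t) (u : L2 N) :
    powerInt q K (t • u) = t ^ q * powerInt q K u := by
  rw [powerInt, powerInt, ← integral_const_mul]
  apply integral_congr_ae
  filter_upwards [Lp.coeFn_smul t u] with x h
  rw [h, Pi.smul_apply, smul_eq_mul, abs_mul, abs_of_pos ht, Real.mul_rpow ht.le (abs_nonneg _)]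
  ring

theorem energy_eq (m μ α q : ℝ) (V K : Space N → ℝ) (f : Space N → ℝ → ℝ) (u : L2 N) :
    energy m μ α q V K f u =
      1 / 2 * quadForm m μ V u - 1 / 2 * doubleInt α f u + 1 / q * powerInt q K u := by
  rw [energy, quadForm, powerInt]; ring

theorem quadForm_smul (m μ : ℝ) (V : Space N → ℝ) (t : ℝ) (u : L2 N) :
    quadForm m μ V (t • u) = t ^ 2 * quadForm m μ V u := by
  rw [quadForm, quadForm, integral_symbol_smul, integral_mul_sq_smul (fun x => V x - m),
    integral_sq_div_norm_smul]
  ring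

/-- The derivative `𝓔'(u)(u)` that defines the Nehari manifold. -/
theorem energyDeriv_self (m μ α : ℝ) (hq : 2 < q) (V K : Space N → ℝ) (f : Space N → ℝ → ℝ)
    (u : L2 N) : energyDeriv m μ α q V K f u u =
      quadForm m μ V u - nonlocalDeriv α f u 1 + powerInt q K u := by
  have e1 : ∀ ξ, (hat u ξ * (starRingEnd ℂ) (hat u ξ)).re = ‖hat u ξ‖ ^ 2 := by
    intro ξ
    rw [Complex.mul_conj, Complex.ofReal_re, Complex.normSq_eq_norm_sq]
  have e2 : ∀ x, |u x| ^ (q - 2) * u x * u x = |u x| ^ q := by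
    intro x
    rw [mul_assoc, ← sq, ← sq_abs, ← Real.rpow_natCast, ← Real.rpow_add' (abs_nonneg _)]
    · congr 1; push_cast; ring
    · push_cast; linarith
  have e3 : ∀ x, K x * |u x| ^ (q - 2) * u x * u x = K x * |u x| ^ q := by
    intro x
    rw [← e2 x]; ring
  have e4 : ∀ x, (V x - m) * u x * u x = (V x - m) * u x ^ 2 := fun x => by ring
  simp only [energyDeriv, quadForm, nonlocalDeriv, powerInt, e1, e3, e4, one_mul, ← sq]

theorem nonlocalDeriv_smul (α : ℝ) (f : Space N → ℝ → ℝ) (u : L2 N) (t : ℝ) :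
    nonlocalDeriv α f (t • u) 1 = nonlocalDeriv α f u t := by
  apply integral_congr_ae
  filter_upwards [ae_prod_of_ae (Lp.coeFn_smul t u)] with w hw
  simp only [hw.1, hw.2, Pi.smul_apply, smul_eq_mul, one_mul]

theorem powerInt_nonneg (hK : CondK K) (u : L2 N) : 0 ≤ powerInt q K u := by
  apply integral_nonneg_of_ae
  filter_upwards [hK.nonneg] with x hx
  exact mul_nonneg hx (by positivity)

namespace IsRegular

theorem nonlocalDeriv_nonneg (hf : IsRegular p q f) (u : L2 N) (t : ℝ) :
    0 ≤ nonlocalDeriv α f u t :=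
  integral_nonneg fun _ => div_nonneg (mul_nonneg (hf.nonneg _ _) (hf.mul_self_nonneg _ _))
    (by positivity)

/-- Every ray meets the Nehari manifold. -/
theorem exists_smul_mem_nehari (hf : IsRegular p q f) (hN : CondN N α p q) (hK : CondK K)
    (hu : u ∈ H12 N) (hu0 : u ≠ 0) (hQ : 0 < quadForm m μ V u) :
    ∃ t : ℝ, 0 < t ∧ t • u ∈ nehari m μ α q V K f := by
  have hq := hN.q_gt
  set Q := quadForm m μ V u
  set B := powerInt q K u
  have hB : 0 ≤ B := powerInt_nonneg hK u
  set M := nonlocalDeriv α f u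
  have hM1 : 0 ≤ M 1 := hf.nonlocalDeriv_nonneg u 1
  let h : ℝ → ℝ := fun t => t ^ 2 * Q - M t + t ^ q * B
  obtain ⟨T, hT, hMT⟩ := hf.exists_nonlocalDeriv_gt hN hu hu0 (Q + B)
  -- for `t ≤ 1` the nonlocal term is at most `t ^ q * M 1`, so that the quadratic term dominates
  -- at `ε`
  set ε := min 1 ((Q / (M 1 + 1)) ^ (1 / (q - 2)))
  have hε : 0 < ε := lt_min one_pos (Real.rpow_pos_of_pos (by positivity) _)
  have hε1 : ε ≤ 1 := min_le_left _ _
  have hcont : ContinuousOn h (Set.Icc ε T) := by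
    have h1 : ContinuousOn M (Set.Icc ε T) :=
      (hf.continuousOn_nonlocalDeriv hN hu T).mono (Set.Icc_subset_Icc hε.le le_rfl)
    have h2 : ContinuousOn (fun t : ℝ => t ^ q) (Set.Icc ε T) :=
      (Real.continuous_rpow_const (by linarith)).continuousOn
    exact ((((continuous_pow 2).continuousOn).mul continuousOn_const).sub h1).add
      (h2.mul continuousOn_const)
  have hT0 : h T ≤ 0 := by
    have h1 : T ^ 2 ≤ T ^ q := by
      rw [← Real.rpow_natCast]
      exact Real.rpow_le_rpow_of_exponent_le hT (by push_cast; linarith)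
    have h2 : T ^ 2 * Q ≤ T ^ q * Q := mul_le_mul_of_nonneg_right h1 hQ.le
    simp only [h]
    linarith
  have hε0 : 0 ≤ h ε := by
    have h1 : M ε ≤ ε ^ q * M 1 := hf.nonlocalDeriv_le hN hu hε hε1
    have h2 : ε ^ (q - 2) ≤ Q / (M 1 + 1) := by
      calc ε ^ (q - 2) ≤ ((Q / (M 1 + 1)) ^ (1 / (q - 2))) ^ (q - 2) :=
            Real.rpow_le_rpow hε.le (min_le_right _ _) (by linarith)
        _ = _ := by
          rw [← Real.rpow_mul (by positivity), one_div_mul_cancel (by linarith), Real.rpow_one]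
    have h3 : ε ^ q = ε ^ 2 * ε ^ (q - 2) := by
      rw [← Real.rpow_natCast, ← Real.rpow_add hε]; congr 1; push_cast; ring
    have h4 : ε ^ (q - 2) * M 1 ≤ Q := by
      calc _ ≤ Q / (M 1 + 1) * M 1 := by gcongr
        _ ≤ Q / (M 1 + 1) * (M 1 + 1) := by gcongr; linarith
        _ = Q := div_mul_cancel₀ _ (by linarith)
    have h5 : ε ^ q * M 1 ≤ ε ^ 2 * Q := by
      rw [h3, mul_assoc]; gcongr
    have h6 : 0 ≤ ε ^ q * B := by positivity
    simp only [h]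
    linarith
  obtain ⟨t, ht, hht⟩ := intermediate_value_Icc' (hε1.trans hT) hcont ⟨hT0, hε0⟩
  have ht0 : 0 < t := hε.trans_le ht.1
  refine ⟨t, ht0, smul_mem_H12 hu t, smul_ne_zero ht0.ne' hu0, ?_⟩
  rw [energyDeriv_self _ _ _ hq, quadForm_smul, nonlocalDeriv_smul, powerInt_smul q K ht0]
  exact hht

/-- On the Nehari manifold the energy is maximal along rays. -/
theorem energy_smul_le (hf : IsRegular p q f) (hN : CondN N α p q)
    (hu : u ∈ nehari m μ α q V K f) (hQ : 0 ≤ quadForm m μ V u) {t : ℝ} (ht : 0 < t) :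
    energy m μ α q V K f (t • u) ≤ energy m μ α q V K f u := by
  obtain ⟨huH, -, hu1⟩ := hu
  have hq := hN.q_gt
  rw [energyDeriv_self _ _ _ hq] at hu1
  have h1 := hf.doubleInt_sub_ge hN huH ht
  rw [one_smul] at h1
  rw [energy_eq, energy_eq, quadForm_smul, powerInt_smul q K ht]
  set Q := quadForm m μ V u
  set B := powerInt q K u
  set M := nonlocalDeriv α f u 1
  have hbern : 1 + q / 2 * (t ^ 2 - 1) ≤ t ^ q := by
    have := one_add_mul_self_le_rpow_one_add (s := t ^ 2 - 1) (by nlinarith) (p := q / 2)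
      (by linarith)
    rw [add_sub_cancel, ← Real.rpow_natCast, ← Real.rpow_mul ht.le] at this
    rw [← Real.rpow_natCast]
    convert this using 2
    push_cast; ring
  -- with `M = Q + B`, the `B` terms of the expansion cancel, and the sign of the `Q` terms is given
  -- by Bernoulli's inequality
  have h2 : (t ^ 2 - 1) / 2 ≤ (t ^ q - 1) / q := by
    rw [div_le_div_iff₀ (by norm_num) (by linarith)]
    linarith
  have h3 : (t ^ 2 - 1) / 2 * Q ≤ (t ^ q - 1) / q * Q := mul_le_mul_of_nonneg_right h2 hQ
  have h4 : M = Q + B := by linarith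
  rw [h4] at h1
  have h5 : 1 / q * (t ^ q * B) = (t ^ q - 1) / q * B + 1 / q * B := by ring
  rw [h5]
  linarith

end IsRegular

theorem integrable_mul_sq {W : Space N → ℝ} (hW : MemLp W ∞ volume) (u : L2 N) :
    Integrable (fun x => W x * u x ^ 2) volume :=
  MemLp.integrable_mul (p := ∞) (q := 1) hW (memLp_one_iff_integrable.2 (integrable_sq u))

/-- The quadratic form, split into its translation invariant and its localized part. -/
theorem quadForm_eq (hV1 : CondV1 V Vp Vl) (u : L2 N) :
    quadForm m μ V u = (∫ ξ, symbol m ξ * ‖hat u ξ‖ ^ 2) + (∫ x, (Vp x - m) * u x ^ 2) +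
      localizedForm μ Vl u := by
  have i1 : Integrable (fun x => (Vp x - m) * u x ^ 2) volume := by
    refine ((integrable_mul_sq hV1.memLp_p u).sub ((integrable_sq u).const_mul m)).congr
      (Eventually.of_forall fun x => ?_)
    simp only [Pi.sub_apply]; ring
  have e : ∫ x, (V x - m) * u x ^ 2 = (∫ x, (Vp x - m) * u x ^ 2) + ∫ x, Vl x * u x ^ 2 := by
    rw [← integral_add i1 (integrable_mul_sq hV1.memLp_l u)]
    apply integral_congr_ae
    filter_upwards [hV1.decomp] with x hx
    rw [hx]; ring
  rw [quadForm, e, localizedForm]; ring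

theorem integral_mul_sq_pos {W : Space N → ℝ} (hW : ∀ᵐ x, 0 < W x)
    (hi : Integrable (fun x => W x * u x ^ 2) volume) (hu0 : u ≠ 0) :
    0 < ∫ x, W x * u x ^ 2 := by
  have h0 : 0 ≤ᵐ[volume] fun x => W x * u x ^ 2 := by
    filter_upwards [hW] with x hx
    exact mul_nonneg hx.le (sq_nonneg _)
  rw [integral_pos_iff_support_of_nonneg_ae h0 hi, pos_iff_ne_zero]
  intro hs
  apply hu0
  rw [Lp.eq_zero_iff_ae_eq_zero]
  filter_upwards [measure_eq_zero_iff_ae_notMem.1 hs, hW] with x h1 h2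
  rw [Function.notMem_support, mul_eq_zero, or_iff_right h2.ne'] at h1
  exact pow_eq_zero_iff (two_ne_zero) |>.1 h1

theorem localizedForm_pos (hN : 2 ≤ N) (hV1 : CondV1 V Vp Vl)
    (hVl : ∀ᵐ x : Space N, μ / ‖x‖ < Vl x) (hu : u ∈ H12 N) (hu0 : u ≠ 0) :
    0 < localizedForm μ Vl u := by
  have i1 := integrable_mul_sq hV1.memLp_l u
  have i2 := (integrable_sq_div_norm hN hu).const_mul μ
  have e : localizedForm μ Vl u = ∫ x, (Vl x - μ / ‖x‖) * u x ^ 2 := by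
    rw [localizedForm, ← integral_const_mul, ← integral_sub i1 i2]
    congr with x; ring
  have i3 : Integrable (fun x => (Vl x - μ / ‖x‖) * u x ^ 2) volume := by
    refine (i1.sub i2).congr (Eventually.of_forall fun x => ?_)
    simp only [Pi.sub_apply]; ring
  rw [e]
  refine integral_mul_sq_pos ?_ i3 hu0
  filter_upwards [hVl] with x hx
  linarith

theorem CondV1.ae_lt_of_lt_essInf (hV1 : CondV1 V Vp Vl) (hV2 : m < essInf Vp volume) :
    ∀ᵐ x, m < Vp x := by
  obtain ⟨C, hC⟩ := exists_ae_abs_le hV1.memLp_p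
  refine _root_.ae_lt_of_lt_essInf hV2 ⟨-C, ?_⟩
  rw [eventually_map]
  filter_upwards [hC] with x hx
  exact (abs_le.1 hx).1

theorem quadForm_pos (hN : 2 ≤ N) (hV1 : CondV1 V Vp Vl) (hV2 : m < essInf Vp volume)
    (hVl : ∀ᵐ x : Space N, μ / ‖x‖ < Vl x) (hu : u ∈ H12 N) (hu0 : u ≠ 0) :
    0 < quadForm m μ V u := by
  rw [quadForm_eq hV1]
  have h1 : 0 ≤ ∫ ξ, symbol m ξ * ‖hat u ξ‖ ^ 2 :=
    integral_nonneg fun ξ => mul_nonneg (Real.sqrt_nonneg _) (sq_nonneg _)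
  have h2 : 0 ≤ ∫ x, (Vp x - m) * u x ^ 2 := by
    apply integral_nonneg_of_ae
    filter_upwards [hV1.ae_lt_of_lt_essInf hV2] with x hx
    exact mul_nonneg (by linarith) (sq_nonneg _)
  linarith [localizedForm_pos hN hV1 hVl hu hu0]

end Nehari

section Translation

variable {N : ℕ} {m μ α p q : ℝ} {V Vp Vl K : Space N → ℝ} {f : Space N → ℝ → ℝ} {u : L2 N}

theorem integral_periodic_mul_shift {W : Space N → ℝ} {z : Fin N → ℤ}
    (hW : ∀ᵐ x, W (x + latticePt z) = W x) (G : ℝ → ℝ) (u : L2 N) :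
    ∫ x, W x * G (shift (latticePt z) u x) = ∫ x, W x * G (u x) := by
  rw [← integral_add_right_eq_self (fun x => W x * G (u x)) (latticePt z)]
  apply integral_congr_ae
  filter_upwards [hW, coeFn_shift (latticePt z) u] with x h1 h2
  rw [h1, h2]

theorem integral_symbol_shift (m : ℝ) (a : Space N) (u : L2 N) :
    ∫ ξ, symbol m ξ * ‖hat (shift a u) ξ‖ ^ 2 = ∫ ξ, symbol m ξ * ‖hat u ξ‖ ^ 2 := by
  apply integral_congr_ae
  filter_upwards [norm_hat_shift a u] with ξ h
  rw [h]

theorem doubleInt_smul_shift (hf : IsRegular p q f) (α t : ℝ) (z : Fin N → ℤ) (u : L2 N) :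
    doubleInt α f (t • shift (latticePt z) u) = doubleInt α f (t • u) := by
  rw [doubleInt_smul, doubleInt_smul, Measure.volume_eq_prod,
    ← integral_add_right_eq_self (μ := (volume : Measure (Space N)).prod volume)
      (fun w : Space N × Space N => primitive f w.1 (t * u w.1) *
      primitive f w.2 (t * u w.2) / ‖w.1 - w.2‖ ^ ((N : ℝ) - α)) (latticePt z, latticePt z)]
  apply integral_congr_ae
  have h : ∀ᵐ x, primitive f x (t * shift (latticePt z) u x) =
      primitive f (x + latticePt z) (t * u (x + latticePt z)) := by
    filter_upwards [hf.periodic z, coeFn_shift (latticePt z) u] with x h1 h2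
    rw [h2]
    simp only [primitive, h1]
  filter_upwards [ae_prod_of_ae h] with w hw
  simp only [Prod.fst_add, Prod.snd_add, add_sub_add_right_eq_sub, hw.1, hw.2]

/-- Only the localized form is affected by a lattice translation. -/
theorem energy_smul_shift (hf : IsRegular p q f) (hV1 : CondV1 V Vp Vl) (hK : CondK K)
    {t : ℝ} (ht : 0 < t) (z : Fin N → ℤ) (u : L2 N) :
    energy m μ α q V K f (t • shift (latticePt z) u) = energy m μ α q V K f (t • u) +
      t ^ 2 / 2 * (localizedForm μ Vl (shift (latticePt z) u) - localizedForm μ Vl u) := by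
  have e1 : powerInt q K (shift (latticePt z) u) = powerInt q K u :=
    integral_periodic_mul_shift (hK.periodic z) (fun s => |s| ^ q) u
  have e2 : ∫ x, (Vp x - m) * shift (latticePt z) u x ^ 2 = ∫ x, (Vp x - m) * u x ^ 2 := by
    refine integral_periodic_mul_shift (W := fun x => Vp x - m) ?_ (fun s => s ^ 2) u
    filter_upwards [hV1.periodic_p z] with x hx
    rw [hx]
  rw [energy_eq, energy_eq, doubleInt_smul_shift hf, quadForm_smul, quadForm_smul,
    powerInt_smul q K ht, powerInt_smul q K ht, quadForm_eq hV1, quadForm_eq hV1, e1, e2,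
    integral_symbol_shift]
  ring

/-- The essential decay of `V_l` at infinity, along translations: the countably many null sets that
it leaves aside may be translated and collected. -/
theorem ae_tendsto_comp_sub (hV1 : CondV1 V Vp Vl) {a : ℕ → Space N}
    (ha : Tendsto (fun n => ‖a n‖) atTop atTop) :
    ∀ᵐ x, Tendsto (fun n => Vl (x - a n)) atTop (𝓝 0) := by
  have h1 : ∀ k : ℕ, ∃ r : ℝ, ∀ᵐ x, r ≤ ‖x‖ → |Vl x| < 1 / ((k : ℝ) + 1) := by
    intro k
    have h := hV1.tendsto_l (Metric.ball_mem_nhds 0 (Nat.one_div_pos_of_nat (n := k)))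
    obtain ⟨s, hs, s', hs', hss⟩ := mem_inf_iff.1 h
    obtain ⟨r, -, hr⟩ := hasBasis_cobounded_norm.mem_iff.1 hs
    refine ⟨r, ?_⟩
    filter_upwards [hs'] with x hx hrx
    have hm : x ∈ Vl ⁻¹' Metric.ball 0 (1 / ((k : ℝ) + 1)) := hss ▸ ⟨hr hrx, hx⟩
    simpa using hm
  choose r hr using h1
  have h2 : ∀ᵐ x, ∀ k n : ℕ, r k ≤ ‖x - a n‖ → |Vl (x - a n)| < 1 / ((k : ℝ) + 1) := by
    rw [ae_all_iff]
    intro k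
    rw [ae_all_iff]
    intro n
    exact (measurePreserving_sub_right volume (a n)).quasiMeasurePreserving.ae (hr k)
  filter_upwards [h2] with x hx
  rw [Metric.tendsto_atTop']
  intro ε hε
  obtain ⟨k, hk⟩ := exists_nat_one_div_lt hε
  obtain ⟨n₀, hn₀⟩ := eventually_atTop.1 (ha.eventually_ge_atTop (r k + ‖x‖))
  refine ⟨n₀, fun n hn => ?_⟩
  rw [dist_zero_right, Real.norm_eq_abs]
  refine (hx k n ?_).trans hk
  have := norm_sub_norm_le (a n) x
  rw [norm_sub_rev] at this
  linarith [hn₀ n hn.le]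

theorem tendsto_integral_mul_shift_sq (hV1 : CondV1 V Vp Vl) (u : L2 N) {a : ℕ → Space N}
    (ha : Tendsto (fun n => ‖a n‖) atTop atTop) :
    Tendsto (fun n => ∫ x, Vl x * shift (a n) u x ^ 2) atTop (𝓝 0) := by
  obtain ⟨C, hC⟩ := exists_ae_abs_le hV1.memLp_l
  have e : ∀ n, ∫ x, Vl x * shift (a n) u x ^ 2 = ∫ x, Vl (x - a n) * u x ^ 2 := by
    intro n
    rw [← integral_add_right_eq_self (fun x => Vl (x - a n) * u x ^ 2) (a n)]
    apply integral_congr_ae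
    filter_upwards [coeFn_shift (a n) u] with x h
    rw [h, add_sub_cancel_right]
  simp_rw [e]
  rw [← integral_zero (Space N) ℝ]
  refine tendsto_integral_of_dominated_convergence (fun x => C * u x ^ 2) (fun n => ?_)
    ((integrable_sq u).const_mul C) (fun n => ?_) ?_
  · exact (hV1.memLp_l.1.comp_measurePreserving (measurePreserving_sub_right volume (a n))).mul
      (integrable_sq u).1
  · filter_upwards [(measurePreserving_sub_right volume (a n)).quasiMeasurePreserving.ae hC]
      with x hx
    rw [Real.norm_eq_abs, abs_mul, abs_of_nonneg (sq_nonneg (u x))]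
    gcongr
  · filter_upwards [ae_tendsto_comp_sub hV1 ha] with x hx
    simpa using hx.mul_const (u x ^ 2)

theorem tendsto_localizedForm_shift (hN : 2 ≤ N) (hV1 : CondV1 V Vp Vl) (hu : u ∈ H12 N)
    {a : ℕ → Space N} (ha : Tendsto (fun n => ‖a n‖) atTop atTop) :
    Tendsto (fun n => localizedForm μ Vl (shift (a n) u)) atTop (𝓝 0) := by
  simpa [localizedForm] using (tendsto_integral_mul_shift_sq hV1 u ha).sub
    ((tendsto_integral_shift_sq_div_norm hN hu ha).const_mul μ)

theorem tendsto_norm_latticePt (hN : 0 < N) :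
    Tendsto (fun n : ℕ => ‖(latticePt fun _ => (n : ℤ) : Space N)‖) atTop atTop := by
  refine tendsto_atTop_mono (fun n => ?_) tendsto_natCast_atTop_atTop
  have := PiLp.norm_apply_le (latticePt fun _ => (n : ℤ) : Space N) ⟨0, hN⟩
  simpa [latticePt] using this

theorem shift_ne_zero (a : Space N) (hu0 : u ≠ 0) : shift a u ≠ 0 := by
  intro h
  apply hu0
  rw [← norm_eq_zero] at h ⊢
  rwa [shift, Lp.norm_compMeasurePreserving] at h

end Translation

/-! ### Nonexistence of minimizers -/

/-- The energy of a regular nonlinearity has no minimizer on the Nehari manifold: a far enough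
lattice translate of a minimizer, rescaled onto the manifold, has strictly smaller energy. -/
theorem IsRegular.not_isMinOn_nehari {N : ℕ} {m μ α p q : ℝ} {V Vp Vl K : Space N → ℝ}
    {f : Space N → ℝ → ℝ} {u : L2 N} (hf : IsRegular p q f) (hN : CondN N α p q)
    (hV1 : CondV1 V Vp Vl) (hV2 : m < essInf Vp volume) (hK : CondK K)
    (hVl : ∀ᵐ x : Space N, μ / ‖x‖ < Vl x) (hu : u ∈ nehari m μ α q V K f) :
    ¬ IsMinOn (energy m μ α q V K f) (nehari m μ α q V K f) u := by
  intro hmin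
  obtain ⟨huH, hu0, -⟩ := id hu
  have h2 := hN.two_le
  have hdecay := tendsto_localizedForm_shift (μ := μ) h2 hV1 huH
    (tendsto_norm_latticePt (by omega))
  obtain ⟨n, hn⟩ := (hdecay.eventually_lt_const (localizedForm_pos h2 hV1 hVl huH hu0)).exists
  set z : Fin N → ℤ := fun _ => (n : ℤ)
  have hsH := shift_mem_H12 huH (latticePt z)
  have hs0 := shift_ne_zero (latticePt z) hu0
  obtain ⟨t, ht, hmem⟩ := hf.exists_smul_mem_nehari hN hK hsH hs0
    (quadForm_pos h2 hV1 hV2 hVl hsH hs0)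
  have h3 := isMinOn_iff.1 hmin _ hmem
  have h4 := hf.energy_smul_le hN hu (quadForm_pos h2 hV1 hV2 hVl huH hu0).le ht
  rw [energy_smul_shift hf hV1 hK ht] at h3
  have h5 := mul_neg_of_pos_of_neg (show 0 < t ^ 2 / 2 by positivity) (sub_neg.2 hn)
  linarith

end Choquard

end

theorem theorem1p2 (N : ℕ) (m μ α p q : ℝ)
    (V Vp Vl K : Choquard.Space N → ℝ) (f : Choquard.Space N → ℝ → ℝ)
    (hm : 0 < m)
    (hN : Choquard.CondN N α p q)
    (hV1 : Choquard.CondV1 V Vp Vl)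
    (hV2' : m < essInf Vp volume)
    (hF1 : Choquard.CondF1 α p f)
    (hF2 : Choquard.CondF2 f)
    (hF3 : Choquard.CondF3 q f)
    (hF4 : Choquard.CondF4 q f)
    (hK : Choquard.CondK K)
    (hμ : μ < 0)
    (hVl : ∀ᵐ x : Choquard.Space N, μ / ‖x‖ < Vl x) :
    (¬ ∃ u, Choquard.IsGroundState m μ α q V K f u) ∧
      (¬ ∃ u ∈ Choquard.nehari m μ α q V K f,
        IsMinOn (Choquard.energy m μ α q V K f) (Choquard.nehari m μ α q V K f) u) := by
  obtain ⟨g, hg, hgf⟩ := Choquard.exists_isRegular hN hF1 hF2 hF3 hF4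
  have hmin : ¬ ∃ u ∈ Choquard.nehari m μ α q V K f,
      IsMinOn (Choquard.energy m μ α q V K f) (Choquard.nehari m μ α q V K f) u := by
    rw [← Choquard.energy_congr hgf, ← Choquard.nehari_congr hgf]
    rintro ⟨u, hu, h⟩
    exact hg.not_isMinOn_nehari hN hV1 hV2' hK hVl hu h
  refine ⟨?_, hmin⟩
  rintro ⟨u, ⟨huH, hweak⟩, hu0, hleast⟩
  exact hmin ⟨u, ⟨huH, hu0, hweak u huH⟩, isMinOn_iff.2 fun v hv =>
    hleast.2 (Set.mem_image_of_mem _ hv)⟩
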